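/- Let $k$ be a field and $\mathfrak g$ a finitely generated Lie algebra over $k$. For a commutative $k$-algebra $A$ write $\mathfrak g_A = A\otimes_k\mathfrak g$ and $\mathfrak g_A^{\mathrm{ab}}=\mathfrak g_A/[\mathfrak g_A,\mathfrak g_A]$. A representation of $\mathfrak g$ over $T=\operatorname{Spec}A$ is a homomorphism $r:\mathfrak g_A\to\operatorname{End}_A(E)$ of Lie algebras over $A$, where $E$ is an $A$-module. Its associated filtration is $E_0=0$, $E_{i+1}=\{e\in E : r(v)e\in E_i \text{ for all } v\in\mathfrak g_A\}$; $r_i$ and $r^i$ denote the induced representations on $E_i$ and on $E/E_i$. For $t\in T$, $r(t)$ is the base change of $r$ to the residue field $\kappa(t)$. *Flag.* An $n$-dimensional representation on a vector space $V$ over a field $K\supseteq k$ is flag if $\dim V_i=i$ for $0\le i\le n$. A representation $r$ over $T=\operatorname{Spec} A$ is flag of rank $n$ if $E$ is locally free of rank $n$, every $E/E_i$ is locally free of finite rank, $E_i$ has rank $i$ for $0\le i\le n$, and the formation of the filtration commutes with base change along every $A\to B$. *Constellation.* Let $r$ be an $n$-dimensional flag representation over a field $K\supseteq k$ on $V$,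 and $L_i=V_i/V_{i-1}$. For $1\le i\le n-1$, $r$ induces a surjection $\kappa_{i,i+1}:\mathfrak g_K^{\mathrm{ab}}\to\operatorname{Hom}_K(L_{i+1},L_i)$ onto a line, that is, a $K$-point of the projective space $\mathbb P\mathfrak g^{\mathrm{ab}}$ of one-dimensional quotients; two such points agree exactly when the kernels agree. The $n-1$ points so obtained are the constellation of $r$, and $r$ is wide if they are pairwise distinct. The width $w\in\{0,1,2,\dots,\infty\}$ of $\mathfrak g$ is the largest $w$ such that a wide representation of $\mathfrak g_K$ of dimension $w+1$ exists over some field $K\supseteq k$ ($w=\infty$ if there is no largest one). *Nondegenerate.* $\operatorname{Aut}r$ denotes the group scheme over $T$ with $B$-points the automorphisms of $r_B$. An $n$-dimensional representation $r$ over a field $K\supseteq k$ on $V$ is nondegenerate if it is flag and, when $n\ge2$, (i) $r_{n-1}$ and $r^1$ are nondegenerate, and (ii) $\dim\operatorname{Aut}r$ is minimal among all $n$-dimensional flag representations over fields containing $k$ that satisfy (i). A representation $r$ of rank $n$ over $T=\operatorname{Spec}A$ is nondegenerate if it is flag of rank $n$, $r_{n-1}$ and $r^1$ are nondegenerate (for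 $n\ge1$; recursion on the rank), $r(t)$ is nondegenerate for every $t\in T$, and $\operatorname{Aut}r$ is flat over $T$. **Proposition.** Let $w$ be the width of $\mathfrak g$, let $n\le w+1$, let $A$ be a commutative $k$-algebra, and let $r$ be a flag representation of $\mathfrak g$ of rank $n$ over $T=\operatorname{Spec}A$. Then $r$ is nondegenerate if and only if for every $t\in T$ the points of the constellation of $r(t)$ are pairwise distinct. -/

import Mathlib

open scoped TensorProduct

universe u v


attribute [local instance 100] LieRing.ofAssociativeRing

namespace FlagRep

noncomputable section

section Basic

/-! Throughout, `g` is a Lie algebra over `k`, `A` is a commutative `k`-algebra and a representation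
of `g` over `T = Spec A` on the quasi-coherent sheaf attached to an `A`-module `E` is a homomorphism
`r : A ⊗[k] g →ₗ⁅A⁆ Module.End A E` of Lie algebras over `A`. -/

variable {k : Type u} [CommRing k] {g : Type v} [LieRing g] [LieAlgebra k g]
variable {A : Type u} [CommRing A] [Algebra k A]
variable {E : Type u} [AddCommGroup E] [Module A E]

/-- The associated filtration: `fil r 0 = 0`, and `fil r (i + 1)` is the preimage in `E` of the
`0`-eigenspace of the representation on `E / fil r i`, that is, the submodule of all `e` such that
`r v e ∈ fil r i` for every `v`. -/
def fil (r : A ⊗[k] g →ₗ⁅A⁆ Module.End A E) : ℕ → Submodule A E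
  | 0 => ⊥
  | i + 1 => ⨅ v : A ⊗[k] g, (fil r i).comap (r v)

theorem mem_fil_succ (r : A ⊗[k] g →ₗ⁅A⁆ Module.End A E) (i : ℕ) (e : E) :
    e ∈ fil r (i + 1) ↔ ∀ v, r v e ∈ fil r i := by
  simp [fil, Submodule.mem_iInf]

theorem fil_le_succ (r : A ⊗[k] g →ₗ⁅A⁆ Module.End A E) (i : ℕ) :
    fil r i ≤ fil r (i + 1) := by
  induction i with
  | zero => simp [fil]
  | succ i ih =>
    intro e he
    rw [mem_fil_succ] at he ⊢
    exact fun v => ih (he v)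

theorem fil_invariant (r : A ⊗[k] g →ₗ⁅A⁆ Module.End A E) (i : ℕ) (v : A ⊗[k] g) (e : E)
    (he : e ∈ fil r i) : r v e ∈ fil r i :=
  (mem_fil_succ r i e).1 (fil_le_succ r i he) v

/-- The subrepresentation on a stable submodule. -/
def subRep (r : A ⊗[k] g →ₗ⁅A⁆ Module.End A E) (p : Submodule A E)
    (h : ∀ v, ∀ e ∈ p, r v e ∈ p) : A ⊗[k] g →ₗ⁅A⁆ Module.End A p where
  toFun v := (r v).restrict (h v)
  map_add' v w := by ext; simp [LinearMap.restrict_apply]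
  map_smul' a v := by ext; simp [LinearMap.restrict_apply]
  map_lie' {v w} := by ext; simp [LinearMap.restrict_apply, LieRing.of_associative_ring_bracket]

/-- The quotient representation by a stable submodule. -/
def quotRep (r : A ⊗[k] g →ₗ⁅A⁆ Module.End A E) (p : Submodule A E)
    (h : ∀ v, ∀ e ∈ p, r v e ∈ p) : A ⊗[k] g →ₗ⁅A⁆ Module.End A (E ⧸ p) where
  toFun v := p.mapQ p (r v) (h v)
  map_add' v w := by ext; simp
  map_smul' a v := by ext; simp
  map_lie' {v w} := by ext; simp [LieRing.of_associative_ring_bracket]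

/-- The subrepresentation `r_i` on the `i`-th step of the associated filtration. -/
def subFil (r : A ⊗[k] g →ₗ⁅A⁆ Module.End A E) (i : ℕ) :
    A ⊗[k] g →ₗ⁅A⁆ Module.End A (fil r i) :=
  subRep r (fil r i) (fil_invariant r i)

/-- The quotient representation `r^i` by the `i`-th step of the associated filtration. -/
def quotFil (r : A ⊗[k] g →ₗ⁅A⁆ Module.End A E) (i : ℕ) :
    A ⊗[k] g →ₗ⁅A⁆ Module.End A (E ⧸ fil r i) :=
  quotRep r (fil r i) (fil_invariant r i)

section BaseChange

variable (B : Type u) [CommRing B] [Algebra k B] [Algebra A B] [IsScalarTower k A B]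

/-- `v ↦ id_B ⊗ r (1 ⊗ v)`. -/
def baseChangeAux (r : A ⊗[k] g →ₗ⁅A⁆ Module.End A E) : g →ₗ[k] Module.End B (B ⊗[A] E) where
  toFun v := (r (1 ⊗ₜ v)).baseChange B
  map_add' v w := by simp [TensorProduct.tmul_add]
  map_smul' c v := by
    have h : (1 : A) ⊗ₜ[k] (c • v) = algebraMap k A c • ((1 : A) ⊗ₜ[k] v) := by
      rw [TensorProduct.smul_tmul', TensorProduct.tmul_smul, algebraMap_smul,
        TensorProduct.smul_tmul']
    have h2 := map_smul r (algebraMap k A c) ((1 : A) ⊗ₜ[k] v)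
    rw [h, h2, LinearMap.baseChange_smul]
    ext e
    simp only [RingHom.id_apply, TensorProduct.AlgebraTensorModule.curry_apply,
      TensorProduct.curry_apply, LinearMap.smul_apply,
      LinearMap.coe_restrictScalars, LinearMap.baseChange_tmul]
    rw [TensorProduct.smul_tmul', TensorProduct.smul_tmul', algebraMap_smul]

/-- The base change `b ⊗ v ↦ b • (id_B ⊗ r (1 ⊗ v))` of `r` along `A → B`, a representation of
`B ⊗[k] g` on `B ⊗[A] E`. -/
def baseChange (r : A ⊗[k] g →ₗ⁅A⁆ Module.End A E) :
    B ⊗[k] g →ₗ⁅B⁆ Module.End B (B ⊗[A] E) where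
  __ := (baseChangeAux B r).liftBaseChange B
  map_lie' {x y} := by
    change (baseChangeAux B r).liftBaseChange B ⁅x, y⁆
      = ⁅(baseChangeAux B r).liftBaseChange B x, (baseChangeAux B r).liftBaseChange B y⁆
    induction x with
    | zero => simp
    | add x₁ x₂ h₁ h₂ => simp only [add_lie, map_add, h₁, h₂]
    | tmul b v =>
      induction y with
      | zero => simp
      | add y₁ y₂ h₁ h₂ => simp only [lie_add, map_add, h₁, h₂]
      | tmul c w =>
        have hvw : (1 : A) ⊗ₜ[k] ⁅v, w⁆ = ⁅(1 : A) ⊗ₜ[k] v, (1 : A) ⊗ₜ[k] w⁆ := by simp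
        have hB : baseChangeAux B r ⁅v, w⁆ = ⁅baseChangeAux B r v, baseChangeAux B r w⁆ := by
          simp only [baseChangeAux, LinearMap.coe_mk, AddHom.coe_mk, hvw, LieHom.map_lie,
            LieRing.of_associative_ring_bracket, LinearMap.baseChange_sub, LinearMap.baseChange_mul]
        simp only [LieAlgebra.ExtendScalars.bracket_tmul, LinearMap.liftBaseChange_tmul, hB,
          smul_lie, lie_smul, mul_comm b c, mul_smul]

end BaseChange

/-- The `i`-th line `L_{i+1} = fil (i + 1) / fil i` (counted from `0`). -/
abbrev gr (r : A ⊗[k] g →ₗ⁅A⁆ Module.End A E) (i : ℕ) : Type u :=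
  fil r (i + 1) ⧸ (fil r i).submoduleOf (fil r (i + 1))

/-- The abelianization `L / [L, L]`. For `L = A ⊗[k] g` this is `A ⊗ g^ab`. -/
abbrev Ab (A : Type*) [CommRing A] (L : Type*) [LieRing L] [LieAlgebra A L] : Type _ :=
  L ⧸ (⁅(⊤ : LieIdeal A L), (⊤ : LieIdeal A L)⁆ : LieIdeal A L).toSubmodule

/-- `r v`, seen as a map from one step of the filtration to the previous one. -/
def down (r : A ⊗[k] g →ₗ⁅A⁆ Module.End A E) (i : ℕ) (v : A ⊗[k] g) :
    fil r (i + 1) →ₗ[A] fil r i :=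
  (r v).restrict fun e he => (mem_fil_succ r i e).1 he v

/-- The map `L_{i+2} → L_{i+1}` of consecutive lines induced by `r v`. -/
def grMap (r : A ⊗[k] g →ₗ⁅A⁆ Module.End A E) (i : ℕ) (v : A ⊗[k] g) :
    gr r (i + 1) →ₗ[A] gr r i :=
  Submodule.mapQ _ _ (down r (i + 1) v) fun e he => by
    simp only [Submodule.submoduleOf, Submodule.mem_comap, Submodule.subtype_apply] at he ⊢
    exact (mem_fil_succ r i e).1 he v

/-- `v ↦ grMap r i v` as a linear map. -/
def grMapLin (r : A ⊗[k] g →ₗ⁅A⁆ Module.End A E) (i : ℕ) :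
    A ⊗[k] g →ₗ[A] gr r (i + 1) →ₗ[A] gr r i where
  toFun := grMap r i
  map_add' v w := by
    ext x
    simp only [grMap, LinearMap.coe_comp, Function.comp_apply, Submodule.mkQ_apply,
      Submodule.mapQ_apply, LinearMap.add_apply, ← Submodule.Quotient.mk_add]
    congr 1
    ext
    simp [down, LinearMap.restrict_apply]
  map_smul' a v := by
    ext x
    simp only [grMap, LinearMap.coe_comp, Function.comp_apply, Submodule.mkQ_apply,
      Submodule.mapQ_apply, LinearMap.smul_apply, RingHom.id_apply, ← Submodule.Quotient.mk_smul]
    congr 1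
    ext
    simp [down, LinearMap.restrict_apply]

theorem grMapLin_bracket (r : A ⊗[k] g →ₗ⁅A⁆ Module.End A E) (i : ℕ) :
    (⁅(⊤ : LieIdeal A (A ⊗[k] g)), (⊤ : LieIdeal A (A ⊗[k] g))⁆ :
      LieIdeal A (A ⊗[k] g)).toSubmodule ≤ LinearMap.ker (grMapLin r i) := by
  rw [LieSubmodule.lieIdeal_oper_eq_linear_span', Submodule.span_le]
  rintro _ ⟨v, -, w, -, rfl⟩
  rw [SetLike.mem_coe, LinearMap.mem_ker]
  refine Submodule.linearMap_qext _ (LinearMap.ext fun x => ?_)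
  change (Submodule.Quotient.mk (down r (i + 1) ⁅v, w⁆ x) : gr r i) = 0
  rw [Submodule.Quotient.mk_eq_zero]
  change r ⁅v, w⁆ x ∈ fil r i
  have hx : ∀ v w, r v (r w x) ∈ fil r i := fun v w =>
    (mem_fil_succ r i _).1 ((mem_fil_succ r (i + 1) _).1 x.2 w) v
  simpa [LieRing.of_associative_ring_bracket] using sub_mem (hx v w) (hx w v)

/-- The canonical matrix entry `κ_{i+1,i+2} : g_A^ab → Hom (L_{i+2}, L_{i+1})`. -/
def kappa (r : A ⊗[k] g →ₗ⁅A⁆ Module.End A E) (i : ℕ) :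
    Ab A (A ⊗[k] g) →ₗ[A] gr r (i + 1) →ₗ[A] gr r i :=
  Submodule.liftQ _ (grMapLin r i) (grMapLin_bracket r i)

/-- An automorphism of the representation `r`. -/
def IsAut (r : A ⊗[k] g →ₗ⁅A⁆ Module.End A E) (α : E ≃ₗ[A] E) : Prop :=
  ∀ v e, α (r v e) = r v (α e)

/-- `R` is a coordinate ring of the group scheme `Aut r` over `Spec A`, that is, `Spec R` represents
the functor `B ↦ Aut (r_B)` on `A`-algebras: there is a universal automorphism `u` of `r_R`, such
that each automorphism `α` of each `r_B` is the base change of `u` along a unique `f : R → B`.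
(An automorphism of `B ⊗[A] E` is determined by its values at the elements `1 ⊗ e`.) -/
def IsAutRing (r : A ⊗[k] g →ₗ⁅A⁆ Module.End A E) (R : Type u) [CommRing R] [Algebra k R]
    [Algebra A R] [IsScalarTower k A R] : Prop :=
  ∃ u : (R ⊗[A] E) ≃ₗ[R] (R ⊗[A] E), IsAut (baseChange R r) u ∧
    ∀ (B : Type u) [CommRing B] [Algebra k B] [Algebra A B] [IsScalarTower k A B]
      (α : (B ⊗[A] E) ≃ₗ[B] (B ⊗[A] E)), IsAut (baseChange B r) α →
      ∃! f : R →ₐ[A] B, ∀ e : E, α (1 ⊗ₜ e) = f.toLinearMap.rTensor E (u (1 ⊗ₜ e))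

/-- `Aut r` is flat over `Spec A`. -/
def AutFlat (r : A ⊗[k] g →ₗ⁅A⁆ Module.End A E) : Prop :=
  ∃ (R : Type u) (_ : CommRing R) (_ : Algebra k R) (_ : Algebra A R) (_ : IsScalarTower k A R),
    IsAutRing r R ∧ Module.Flat A R

/-- The dimension of the scheme `Aut r`. A coordinate ring is unique up to isomorphism, and it
exists when `E` is finite and projective (`Aut r` is then a closed subscheme of `GL(E)`), so the
infimum is over a set with exactly one element. -/
def autDim (r : A ⊗[k] g →ₗ⁅A⁆ Module.End A E) : WithBot ℕ∞ :=
  sInf {d | ∃ (R : Type u) (_ : CommRing R) (_ : Algebra k R) (_ : Algebra A R)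
    (_ : IsScalarTower k A R), IsAutRing r R ∧ d = ringKrullDim R}

/-- `r` is a flag representation on a vector sheaf of rank `n` over `Spec A`: `E` is locally free of
rank `n`, each step of the associated filtration is a vector subsheaf (locally free quotient), the
`i`-th step has rank `i` for `i ≤ n` (the filtration is a full flag), and the formation of the
filtration is compatible with base change. -/
structure IsFlag (r : A ⊗[k] g →ₗ⁅A⁆ Module.End A E) (n : ℕ) : Prop where
  finite : Module.Finite A E
  projective : Module.Projective A E
  rank_eq : ∀ p : PrimeSpectrum A, Module.rankAtStalk E p = n
  projective_quot : ∀ i, Module.Projective A (E ⧸ fil r i)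
  rank_fil : ∀ i ≤ n, ∀ p : PrimeSpectrum A, Module.rankAtStalk (fil r i) p = i
  base_change : ∀ (B : Type u) [CommRing B] [Algebra k B] [Algebra A B] [IsScalarTower k A B]
    (i : ℕ), fil (baseChange B r) i = (fil r i).baseChange B

/-- The fibre `r(t)` of `r` at a point `t` of `Spec A`, a representation over the residue field. -/
abbrev fiber (r : A ⊗[k] g →ₗ⁅A⁆ Module.End A E) (t : PrimeSpectrum A) :
    t.asIdeal.ResidueField ⊗[k] g →ₗ⁅t.asIdeal.ResidueField⁆
      Module.End t.asIdeal.ResidueField (t.asIdeal.ResidueField ⊗[A] E) :=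
  baseChange t.asIdeal.ResidueField r

end Basic

section Field

variable {k : Type u} [Field k] {g : Type v} [LieRing g] [LieAlgebra k g]
variable {K : Type u} [Field K] [Algebra k K]
variable {V : Type u} [AddCommGroup V] [Module K V]

/-- A representation over a field is an `n`-dimensional flag representation if its associated
filtration is a full flag `0 = V_0 ⊂ V_1 ⊂ ⋯ ⊂ V_n = V`, `dim V_i = i`. (It is then nilpotent, the
filtration being exhaustive.) -/
structure IsFieldFlag (r : K ⊗[k] g →ₗ⁅K⁆ Module.End K V) (n : ℕ) : Prop where
  finite : FiniteDimensional K V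
  finrank_eq : Module.finrank K V = n
  finrank_fil : ∀ i ≤ n, Module.finrank K (fil r i) = i

/-- The points of the constellation `(κ_{1,2}, …, κ_{n-1,n})` of an `n`-dimensional flag
representation over a field `K`. A `K`-point of the projective space `ℙ(g^ab)` of one-dimensional
quotients of `g_K^ab` is given by the kernel of the quotient map; the point `κ_{i+1,i+2}` is the
kernel of the surjection `κ_{i+1,i+2} : g_K^ab → Hom (L_{i+2}, L_{i+1})`. -/
def constellation (r : K ⊗[k] g →ₗ⁅K⁆ Module.End K V) (n : ℕ) (i : Fin (n - 1)) :
    Submodule K (Ab K (K ⊗[k] g)) :=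
  LinearMap.ker (kappa r i)

/-- An `n`-dimensional representation over a field is wide if it is flag and the points of its
constellation are pairwise distinct. -/
def IsWide (r : K ⊗[k] g →ₗ⁅K⁆ Module.End K V) (n : ℕ) : Prop :=
  IsFieldFlag r n ∧ Function.Injective (constellation r n)

end Field

/-- The nilpotent width of `g`: the largest `w` such that a wide representation of dimension
`w + 1` of `g_K` exists over some field `K` containing `k` (`⊤` if there is no largest one). -/
def width (k : Type u) [Field k] (g : Type v) [LieRing g] [LieAlgebra k g] : ℕ∞ :=
  sSup {w : ℕ∞ | ∃ m : ℕ, w = m ∧ ∃ (K : Type u) (_ : Field K) (_ : Algebra k K) (V : Type u)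
    (_ : AddCommGroup V) (_ : Module K V) (r : K ⊗[k] g →ₗ⁅K⁆ Module.End K V), IsWide r (m + 1)}

/-- Nondegeneracy of an `n`-dimensional nilpotent representation `r` of `g_K` over a field `K`
containing `k`. For `n ≥ 2`: `r` is flag, the subrepresentation on `V_{n-1}` and the quotient
representation on `V / V_1` are nondegenerate, and `dim Aut r` is minimal among the
`n`-dimensional flag representations with this property over all fields containing `k`. -/
def IsFieldNondeg (k : Type u) [Field k] (g : Type v) [LieRing g] [LieAlgebra k g] :
    (n : ℕ) → ∀ (K : Type u) [Field K] [Algebra k K] (V : Type u) [AddCommGroup V] [Module K V],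
      (K ⊗[k] g →ₗ⁅K⁆ Module.End K V) → Prop
  | 0 => fun _ _ _ _ _ _ r => IsFieldFlag r 0
  | 1 => fun _ _ _ _ _ _ r => IsFieldFlag r 1
  | n + 2 => fun K _ _ V _ _ r =>
      IsFieldFlag r (n + 2) ∧
      IsFieldNondeg k g (n + 1) K (fil r (n + 1)) (subFil r (n + 1)) ∧
      IsFieldNondeg k g (n + 1) K (V ⧸ fil r 1) (quotFil r 1) ∧
      ∀ (K' : Type u) [Field K'] [Algebra k K'] (V' : Type u) [AddCommGroup V'] [Module K' V']
        (r' : K' ⊗[k] g →ₗ⁅K'⁆ Module.End K' V'),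
        IsFieldFlag r' (n + 2) →
        IsFieldNondeg k g (n + 1) K' (fil r' (n + 1)) (subFil r' (n + 1)) →
        IsFieldNondeg k g (n + 1) K' (V' ⧸ fil r' 1) (quotFil r' 1) →
        autDim r ≤ autDim r'

/-- Nondegeneracy of a representation `r` on a vector sheaf of rank `n` over `Spec A`: `r` is flag,
its subrepresentation `r_{n-1}` and its quotient `r^1` are nondegenerate (for `n ≥ 1`), its fibres
are nondegenerate, and `Aut r` is flat over `Spec A`. -/
def IsNondeg (k : Type u) [Field k] (g : Type v) [LieRing g] [LieAlgebra k g]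
    (A : Type u) [CommRing A] [Algebra k A] :
    (n : ℕ) → ∀ (E : Type u) [AddCommGroup E] [Module A E],
      (A ⊗[k] g →ₗ⁅A⁆ Module.End A E) → Prop
  | 0 => fun _ _ _ r =>
      IsFlag r 0 ∧ (∀ t : PrimeSpectrum A, IsFieldNondeg k g 0 _ _ (fiber r t)) ∧ AutFlat r
  | n + 1 => fun E _ _ r =>
      IsFlag r (n + 1) ∧
      IsNondeg k g A n (fil r n) (subFil r n) ∧ IsNondeg k g A n (E ⧸ fil r 1) (quotFil r 1) ∧
      (∀ t : PrimeSpectrum A, IsFieldNondeg k g (n + 1) _ _ (fiber r t)) ∧ AutFlat r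

end

end FlagRep

/-! Everything rests on computing the endomorphisms of r after an arbitrary base change A → B.
Endomorphisms preserve the filtration. If the fibres are wide, each endomorphism is a scalar b plus
a map E/E_{n-1} → E_1 (`IsValuedEndo.exists_scalar_of_wide`). The proof is by induction on the rank.
The statement for r_{n-1} and r^1 gives two scalars, which agree because both describe the action on
the line E_2/E_1. After subtracting the scalar, the entries left to control are the one from L_{n-1}
to L_1 and the one from L_n to L_2. Commuting with r ties them together by a linear relation between
κ_{1,2} and κ_{n-1,n}. These are independent in every fibre, so both entries vanish
(`IsValuedEndo.cancel`).

Hence for n ≥ 2, Aut r is the product of the multiplicative group and the vector group of maps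
E/E_{n-1} → E_1 (`isAutRing_unitRing`). It is flat, and over a field its dimension is at most 2.

Over a field there are lower bounds as well. Every flag representation of dimension n ≥ 2 has dim
Aut ≥ 2, from the scalars and the maps L_n → L_1. If κ_{1,2} and κ_{n-1,n} have the same kernel, the
relation above has a nonzero solution and dim Aut ≥ 3 (`IsFieldFlag.three_le_autDim`). Since n ≤ w +
1, a wide representation of dimension n exists, so the minimum in the definition of nondegeneracy is
2. By induction r_{n-1} and r^1 are wide, which leaves only the first and last points to compare,
and minimality separates them (`isFieldNondeg_iff_isWide`). Over A, the fibres are handled by the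
field case and flatness by the description of Aut r.

The lines of the filtration need not be free over A. Arguments with coordinates therefore use
vectors and linear forms that become bases at one residue field; the resulting denominators are
removed by `mem_of_forall_prime`. -/

namespace FlagRep

/-! ### Filtration and line maps under equivariant maps and base change -/

section Transport

variable {k : Type u} [CommRing k] {g : Type v} [LieRing g] [LieAlgebra k g]
variable {A : Type u} [CommRing A] [Algebra k A]
variable {E : Type u} [AddCommGroup E] [Module A E]
variable {F : Type u} [AddCommGroup F] [Module A F]

theorem fil_mono (r : A ⊗[k] g →ₗ⁅A⁆ Module.End A E) : Monotone (fil r) :=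
  monotone_nat_of_le_succ (fil_le_succ r)

theorem fil_zero (r : A ⊗[k] g →ₗ⁅A⁆ Module.End A E) : fil r 0 = ⊥ := rfl

theorem mem_fil_one (r : A ⊗[k] g →ₗ⁅A⁆ Module.End A E) (e : E) :
    e ∈ fil r 1 ↔ ∀ v, r v e = 0 := by
  simp [mem_fil_succ, fil_zero]

theorem map_tensor_mem_of_forall_one_tmul {r : A ⊗[k] g →ₗ⁅A⁆ Module.End A E}
    {p : Submodule A E} {e : E} (h : ∀ v : g, r (1 ⊗ₜ v) e ∈ p) (v : A ⊗[k] g) : r v e ∈ p := by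
  induction v with
  | zero => simp
  | add x y hx hy => simpa using add_mem hx hy
  | tmul a v =>
    have : a ⊗ₜ[k] v = a • ((1 : A) ⊗ₜ[k] v) := by simp [TensorProduct.smul_tmul']
    rw [this, map_smul]
    exact p.smul_mem a (h v)

theorem fil_eq_comap {r : A ⊗[k] g →ₗ⁅A⁆ Module.End A E} {s : A ⊗[k] g →ₗ⁅A⁆ Module.End A F}
    {φ : F →ₗ[A] E} (hφ : Function.Injective φ) (h : ∀ v x, φ (s v x) = r v (φ x)) (i : ℕ) :
    fil s i = (fil r i).comap φ := by
  induction i with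
  | zero => simp [fil_zero, LinearMap.ker_eq_bot.2 hφ]
  | succ i ih =>
    ext x
    simp [mem_fil_succ, ih, h]

/-- Both filtrations obey the same recursion, and the hypothesis on the kernel starts the one on the
target one index later. -/
theorem comap_fil_eq {r : A ⊗[k] g →ₗ⁅A⁆ Module.End A E} {s : A ⊗[k] g →ₗ⁅A⁆ Module.End A F}
    {ψ : E →ₗ[A] F} (hker : LinearMap.ker ψ = fil r 1)
    (h : ∀ v x, ψ (r v x) = s v (ψ x)) (i : ℕ) :
    (fil s i).comap ψ = fil r (i + 1) := by
  induction i with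
  | zero => simpa [fil_zero] using hker
  | succ i ih =>
    ext x
    rw [mem_fil_succ r (i + 1), Submodule.mem_comap, mem_fil_succ]
    simp only [← ih, Submodule.mem_comap, h]

/-- An elementwise form, so that kernels for different representations can be compared without
identifying their subquotients `gr r i`. -/
theorem mem_ker_grMapLin {r : A ⊗[k] g →ₗ⁅A⁆ Module.End A E} {i : ℕ} {v : A ⊗[k] g} :
    v ∈ LinearMap.ker (grMapLin r i) ↔ ∀ e ∈ fil r (i + 2), r v e ∈ fil r i := by
  rw [LinearMap.mem_ker]
  constructor
  · intro h e he
    have := LinearMap.congr_fun h (Submodule.Quotient.mk ⟨e, he⟩)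
    change (Submodule.Quotient.mk (down r (i + 1) v ⟨e, he⟩) : gr r i) = 0 at this
    rw [Submodule.Quotient.mk_eq_zero] at this
    exact this
  · intro h
    refine Submodule.linearMap_qext _ (LinearMap.ext fun x => ?_)
    change (Submodule.Quotient.mk (down r (i + 1) v x) : gr r i) = 0
    rw [Submodule.Quotient.mk_eq_zero]
    exact h x x.2

theorem comap_ker_kappa (r : A ⊗[k] g →ₗ⁅A⁆ Module.End A E) (i : ℕ) :
    (LinearMap.ker (kappa r i)).comap (Submodule.mkQ _) = LinearMap.ker (grMapLin r i) := by
  rw [kappa, ← LinearMap.ker_comp, Submodule.liftQ_mkQ]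

/-- The kernels of the first `n - 1` maps between consecutive lines are pairwise distinct. -/
def StepInjective (r : A ⊗[k] g →ₗ⁅A⁆ Module.End A E) (n : ℕ) : Prop :=
  ∀ i j, i + 1 < n → j + 1 < n →
    LinearMap.ker (grMapLin r i) = LinearMap.ker (grMapLin r j) → i = j

theorem ker_grMapLin_of_injective {r : A ⊗[k] g →ₗ⁅A⁆ Module.End A E}
    {s : A ⊗[k] g →ₗ⁅A⁆ Module.End A F}
    {φ : F →ₗ[A] E} (hφ : Function.Injective φ) (h : ∀ v x, φ (s v x) = r v (φ x)) {i : ℕ}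
    (hi : fil r (i + 2) ≤ LinearMap.range φ) :
    LinearMap.ker (grMapLin s i) = LinearMap.ker (grMapLin r i) := by
  ext v
  simp only [mem_ker_grMapLin, fil_eq_comap hφ h, Submodule.mem_comap, h]
  constructor
  · intro H e he
    obtain ⟨x, rfl⟩ := hi he
    exact H x he
  · exact fun H x hx => H _ hx

theorem ker_grMapLin_of_surjective {r : A ⊗[k] g →ₗ⁅A⁆ Module.End A E}
    {s : A ⊗[k] g →ₗ⁅A⁆ Module.End A F}
    {ψ : E →ₗ[A] F} (hψ : Function.Surjective ψ) (hker : LinearMap.ker ψ = fil r 1)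
    (h : ∀ v x, ψ (r v x) = s v (ψ x)) (i : ℕ) :
    LinearMap.ker (grMapLin s i) = LinearMap.ker (grMapLin r (i + 1)) := by
  ext v
  have hf := fun j => comap_fil_eq hker h j
  simp only [mem_ker_grMapLin, ← hf, Submodule.mem_comap]
  simp only [h]
  exact hψ.forall (p := fun e => e ∈ fil s (i + 2) → s v e ∈ fil s i)

theorem StepInjective.of_injective {r : A ⊗[k] g →ₗ⁅A⁆ Module.End A E}
    {s : A ⊗[k] g →ₗ⁅A⁆ Module.End A F} {φ : F →ₗ[A] E} (hφ : Function.Injective φ)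
    (h : ∀ v x, φ (s v x) = r v (φ x)) {n m : ℕ} (hn : fil r n ≤ LinearMap.range φ) (hnm : n ≤ m)
    (hr : StepInjective r m) : StepInjective s n := by
  intro i j hi hj hij
  rw [ker_grMapLin_of_injective hφ h ((fil_mono r hi).trans hn),
    ker_grMapLin_of_injective hφ h ((fil_mono r hj).trans hn)] at hij
  exact hr i j (hi.trans_le hnm) (hj.trans_le hnm) hij

theorem StepInjective.of_surjective {r : A ⊗[k] g →ₗ⁅A⁆ Module.End A E}
    {s : A ⊗[k] g →ₗ⁅A⁆ Module.End A F} {ψ : E →ₗ[A] F} (hψ : Function.Surjective ψ)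
    (hker : LinearMap.ker ψ = fil r 1) (h : ∀ v x, ψ (r v x) = s v (ψ x)) {n : ℕ}
    (hr : StepInjective r (n + 1)) : StepInjective s n := by
  intro i j hi hj hij
  rw [ker_grMapLin_of_surjective hψ hker h, ker_grMapLin_of_surjective hψ hker h] at hij
  simpa using hr (i + 1) (j + 1) (by omega) (by omega) hij

theorem subtype_subFil (r : A ⊗[k] g →ₗ⁅A⁆ Module.End A E) (m : ℕ) (v : A ⊗[k] g) (x : fil r m) :
    (fil r m).subtype (subFil r m v x) = r v ((fil r m).subtype x) := rfl

theorem mkQ_quotFil (r : A ⊗[k] g →ₗ⁅A⁆ Module.End A E) (m : ℕ) (v : A ⊗[k] g) (x : E) :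
    (fil r m).mkQ (r v x) = quotFil r m v ((fil r m).mkQ x) := rfl

theorem fil_subFil (r : A ⊗[k] g →ₗ⁅A⁆ Module.End A E) (m i : ℕ) :
    fil (subFil r m) i = (fil r i).comap (fil r m).subtype :=
  fil_eq_comap (fil r m).subtype_injective (subtype_subFil r m) i

theorem comap_fil_quotFil (r : A ⊗[k] g →ₗ⁅A⁆ Module.End A E) (i : ℕ) :
    (fil (quotFil r 1) i).comap (fil r 1).mkQ = fil r (i + 1) :=
  comap_fil_eq (by simp) (mkQ_quotFil r 1) i

theorem fil_quotFil (r : A ⊗[k] g →ₗ⁅A⁆ Module.End A E) (i : ℕ) :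
    fil (quotFil r 1) i = (fil r (i + 1)).map (fil r 1).mkQ := by
  have h := congrArg (Submodule.map (fil r 1).mkQ) (comap_fil_quotFil r i)
  rwa [Submodule.map_comap_eq_of_surjective (Submodule.mkQ_surjective _)] at h

section BaseChange

variable (B : Type u) [CommRing B] [Algebra k B] [Algebra A B] [IsScalarTower k A B]

theorem baseChange_tmul (r : A ⊗[k] g →ₗ⁅A⁆ Module.End A E) (b : B) (v : g) :
    baseChange B r (b ⊗ₜ v) = b • (r (1 ⊗ₜ v)).baseChange B := by
  change (baseChangeAux B r).liftBaseChange B (b ⊗ₜ v) = _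
  simp [baseChangeAux]

theorem baseChange_one_tmul_one_tmul (r : A ⊗[k] g →ₗ⁅A⁆ Module.End A E) (v : g) (e : E) :
    baseChange B r (1 ⊗ₜ v) (1 ⊗ₜ e) = 1 ⊗ₜ r (1 ⊗ₜ v) e := by
  simp [baseChange_tmul]

theorem baseChange_equivariant {r : A ⊗[k] g →ₗ⁅A⁆ Module.End A E}
    {s : A ⊗[k] g →ₗ⁅A⁆ Module.End A F} {φ : E →ₗ[A] F} (h : ∀ v x, φ (r v x) = s v (φ x))
    (v : B ⊗[k] g) (z : B ⊗[A] E) :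
    φ.baseChange B (baseChange B r v z) = baseChange B s v (φ.baseChange B z) := by
  induction v with
  | zero => simp
  | add x y hx hy => simp [hx, hy]
  | tmul b v =>
    induction z with
    | zero => simp
    | add x y hx hy => simp only [map_add, hx, hy]
    | tmul c e => simp [baseChange_tmul, h]

/-- `r v` for `v` over `A`, extended to `B`, commutes with everything the way `1 ⊗ v` does. -/
theorem forall_baseChange_iff (r : A ⊗[k] g →ₗ⁅A⁆ Module.End A E) (p : Submodule B (B ⊗[A] E))
    (z : B ⊗[A] E) :
    (∀ v : B ⊗[k] g, baseChange B r v z ∈ p) ↔ ∀ v : A ⊗[k] g, (r v).baseChange B z ∈ p := by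
  constructor
  · intro h v
    induction v with
    | zero => simp
    | add x y hx hy => simpa [LinearMap.baseChange_add] using add_mem hx hy
    | tmul a v =>
      have : a ⊗ₜ[k] v = a • ((1 : A) ⊗ₜ[k] v) := by simp [TensorProduct.smul_tmul']
      rw [this, map_smul, LinearMap.baseChange_smul]
      have h1 := h (1 ⊗ₜ v)
      rw [baseChange_tmul, one_smul] at h1
      simpa using p.smul_of_tower_mem a h1
  · intro h
    refine map_tensor_mem_of_forall_one_tmul fun v => ?_
    rw [baseChange_tmul, one_smul]
    exact h _

theorem mem_fil_baseChange_succ (r : A ⊗[k] g →ₗ⁅A⁆ Module.End A E) (i : ℕ) (z : B ⊗[A] E) :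
    z ∈ fil (baseChange B r) (i + 1) ↔
      ∀ v : A ⊗[k] g, (r v).baseChange B z ∈ fil (baseChange B r) i := by
  rw [mem_fil_succ, forall_baseChange_iff]

end BaseChange

end Transport

/-! ### Submodules with projective quotient -/

section Split

variable {A : Type u} [CommRing A] {E : Type u} [AddCommGroup E] [Module A E]

theorem exists_projection (p : Submodule A E) [Module.Projective A (E ⧸ p)] :
    ∃ π : E →ₗ[A] p, ∀ x : p, π x = x := by
  obtain ⟨s, hs⟩ := Module.projective_lifting_property p.mkQ LinearMap.id p.mkQ_surjective
  have hs' : ∀ y, p.mkQ (s y) = y := fun y => LinearMap.congr_fun hs y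
  refine ⟨(LinearMap.id - s ∘ₗ p.mkQ).codRestrict p fun x => ?_, fun x => ?_⟩
  · refine Subtype.ext ?_
    simp [(Submodule.Quotient.mk_eq_zero p).2 x.2]
  · rw [← Submodule.Quotient.mk_eq_zero, ← Submodule.mkQ_apply]
    simp [-Submodule.mkQ_apply, hs']

theorem baseChange_subtype_injective (B : Type u) [CommRing B] [Algebra A B] (p : Submodule A E)
    [Module.Projective A (E ⧸ p)] : Function.Injective (p.subtype.baseChange B) := by
  obtain ⟨π, hπ⟩ := exists_projection p
  refine Function.LeftInverse.injective (g := π.baseChange B) fun z => ?_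
  rw [← LinearMap.comp_apply, ← LinearMap.baseChange_comp,
    show π ∘ₗ p.subtype = LinearMap.id from LinearMap.ext hπ, LinearMap.baseChange_id]
  rfl

theorem finite_of_projective_quotient (p : Submodule A E) [Module.Finite A E]
    [Module.Projective A (E ⧸ p)] : Module.Finite A p := by
  obtain ⟨π, hπ⟩ := exists_projection p
  exact Module.Finite.of_surjective π fun x => ⟨x, hπ x⟩

theorem projective_of_projective_quotient (p : Submodule A E) [Module.Projective A E]
    [Module.Projective A (E ⧸ p)] : Module.Projective A p := by
  obtain ⟨π, hπ⟩ := exists_projection p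
  exact Module.Projective.of_split p.subtype π (LinearMap.ext hπ)

theorem rankAtStalk_eq_add (p : Submodule A E) [Module.Finite A E] [Module.Projective A E]
    [Module.Projective A (E ⧸ p)] (t : PrimeSpectrum A) :
    Module.rankAtStalk E t = Module.rankAtStalk p t + Module.rankAtStalk (E ⧸ p) t := by
  have := finite_of_projective_quotient p
  have := projective_of_projective_quotient p
  obtain ⟨π, hπ⟩ := exists_projection p
  have hbij : Function.Bijective (π.prod p.mkQ) := by
    constructor
    · rw [← LinearMap.ker_eq_bot, LinearMap.ker_prod, eq_bot_iff]
      rintro x ⟨h1, h2⟩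
      rw [SetLike.mem_coe, Submodule.ker_mkQ] at h2
      have := hπ ⟨x, h2⟩
      rw [SetLike.mem_coe, LinearMap.mem_ker] at h1
      simpa [h1] using this.symm
    · rintro ⟨a, b⟩
      obtain ⟨b, rfl⟩ := p.mkQ_surjective b
      refine ⟨b - (π b : E) + a, ?_⟩
      simp [hπ, (Submodule.Quotient.mk_eq_zero p).2 (π b).2, (Submodule.Quotient.mk_eq_zero p).2 a.2]
  rw [Module.rankAtStalk_eq_of_equiv (LinearEquiv.ofBijective _ hbij), Module.rankAtStalk_prod]
  rfl

/-- Lying in the range, `p` is the image of its preimage. Images commute with base change, and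
injectivity after base change recovers the preimage. -/
theorem comap_baseChange_eq {F : Type u} [AddCommGroup F] [Module A F] (B : Type u) [CommRing B]
    [Algebra A B] {φ : F →ₗ[A] E} (hφ : Function.Injective (φ.baseChange B)) {p : Submodule A E}
    (hp : p ≤ LinearMap.range φ) :
    (p.baseChange B).comap (φ.baseChange B) = (p.comap φ).baseChange B := by
  have hmap : p.baseChange B = ((p.comap φ).baseChange B).map (φ.baseChange B) := by
    have : p = (p.comap φ).map φ := by rw [Submodule.map_comap_eq, inf_eq_right.2 hp]
    apply le_antisymm
    · conv_lhs => rw [this]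
      rw [Submodule.baseChange_eq_span, Submodule.span_le]
      rintro _ ⟨_, ⟨y, hy, rfl⟩, rfl⟩
      exact ⟨1 ⊗ₜ y, Submodule.tmul_mem_baseChange_of_mem _ hy, by simp⟩
    · rw [Submodule.map_le_iff_le_comap, Submodule.baseChange_eq_span, Submodule.span_le]
      rintro _ ⟨y, hy, rfl⟩
      exact Submodule.tmul_mem_baseChange_of_mem _ hy
  rw [hmap, Submodule.comap_map_eq_of_injective hφ]

theorem map_mkQ_baseChange {F : Type u} [AddCommGroup F] [Module A F] (B : Type u) [CommRing B]
    [Algebra A B] (φ : E →ₗ[A] F) (p : Submodule A E) :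
    (p.baseChange B).map (φ.baseChange B) = (p.map φ).baseChange B := by
  apply le_antisymm
  · rw [Submodule.map_le_iff_le_comap, Submodule.baseChange_eq_span, Submodule.span_le]
    rintro _ ⟨y, hy, rfl⟩
    exact Submodule.tmul_mem_baseChange_of_mem _ ⟨y, hy, rfl⟩
  · rw [Submodule.baseChange_eq_span, Submodule.span_le]
    rintro _ ⟨_, ⟨y, hy, rfl⟩, rfl⟩
    exact ⟨1 ⊗ₜ y, Submodule.tmul_mem_baseChange_of_mem _ hy, by simp⟩

theorem ker_baseChange_mkQ (B : Type u) [CommRing B] [Algebra A B] (p : Submodule A E) :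
    LinearMap.ker (p.mkQ.baseChange B) = p.baseChange B := by
  have h := lTensor_exact B (LinearMap.exact_subtype_mkQ p) p.mkQ_surjective
  ext z
  rw [LinearMap.mem_ker, LinearMap.baseChange_eq_ltensor, h z, Submodule.baseChange,
    LinearMap.mem_range, Set.mem_range]
  rfl

end Split

/-! ### Heredity of the flag property -/

section Flag

variable {k : Type u} [CommRing k] {g : Type v} [LieRing g] [LieAlgebra k g]
variable {A : Type u} [CommRing A] [Algebra k A]
variable {E : Type u} [AddCommGroup E] [Module A E]
variable {r : A ⊗[k] g →ₗ⁅A⁆ Module.End A E} {n : ℕ}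

theorem IsFlag.finite_fil (hr : IsFlag r n) (i : ℕ) : Module.Finite A (fil r i) :=
  have := hr.finite
  have := hr.projective_quot i
  finite_of_projective_quotient _

theorem IsFlag.projective_fil (hr : IsFlag r n) (i : ℕ) : Module.Projective A (fil r i) :=
  have := hr.projective
  have := hr.projective_quot i
  projective_of_projective_quotient _

theorem IsFlag.rank_quot (hr : IsFlag r n) {i : ℕ} (hi : i ≤ n) (t : PrimeSpectrum A) :
    Module.rankAtStalk (E ⧸ fil r i) t = n - i := by
  have := hr.finite
  have := hr.projective
  have := hr.projective_quot i
  have h := rankAtStalk_eq_add (fil r i) t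
  rw [hr.rank_eq, hr.rank_fil i hi] at h
  omega

theorem IsFlag.fil_eq_top (hr : IsFlag r n) {i : ℕ} (hi : n ≤ i) : fil r i = ⊤ := by
  suffices fil r n = ⊤ from top_le_iff.1 (this ▸ fil_mono r hi)
  have := hr.finite
  have := hr.projective_quot n
  rw [← Submodule.Quotient.subsingleton_iff,
    ← Module.rankAtStalk_eq_zero_iff_subsingleton (R := A)]
  ext t
  rw [hr.rank_quot le_rfl]
  simp

/-- The steps of the filtration of a flag representation are flag representations. -/
theorem IsFlag.subFil (hr : IsFlag r n) {m : ℕ} (hm : m ≤ n) : IsFlag (subFil r m) m where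
  finite := hr.finite_fil m
  projective := hr.projective_fil m
  rank_eq := hr.rank_fil m hm
  projective_quot i := by
    have := hr.projective_quot i
    have := hr.projective_quot m
    have := hr.projective
    rw [fil_subFil]
    rcases le_total m i with h | h
    · have : (fil r i).comap (fil r m).subtype = ⊤ := by
        rw [Submodule.comap_subtype_eq_top]; exact fil_mono r h
      rw [this]
      infer_instance
    -- A retraction of E onto E_m fixes E_i pointwise when i ≤ m, so it descends and exhibits
    -- E_m/E_i as a direct summand of E/E_i.
    · obtain ⟨π, hπ⟩ := exists_projection (fil r m)
      refine Module.Projective.of_split (M := E ⧸ fil r i)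
        (Submodule.mapQ _ _ (fil r m).subtype le_rfl)
        (Submodule.mapQ _ _ π fun x hx => ?_) ?_
      · have := hπ ⟨x, fil_mono r h hx⟩
        simp only [Submodule.mem_comap, Submodule.subtype_apply]
        simp only at this
        rwa [this]
      · refine Submodule.linearMap_qext _ (LinearMap.ext fun x => ?_)
        simp [hπ]
  rank_fil i hi t := by
    rw [fil_subFil, Module.rankAtStalk_eq_of_equiv
      (Submodule.comapSubtypeEquivOfLe (fil_mono r hi)), hr.rank_fil i (hi.trans hm) t]
  base_change B _ _ _ _ i := by
    have := hr.projective_quot m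
    have hinj := baseChange_subtype_injective B (fil r m)
    rw [fil_eq_comap hinj (baseChange_equivariant B (subtype_subFil r m)), fil_subFil,
      hr.base_change]
    rcases le_total i m with h | h
    · exact comap_baseChange_eq B hinj (by simpa using fil_mono r h)
    · have h1 : (fil r i).comap (fil r m).subtype = ⊤ := by
        rw [Submodule.comap_subtype_eq_top]; exact fil_mono r h
      rw [h1, Submodule.baseChange_top, eq_top_iff]
      rintro z -
      exact Submodule.baseChange_mono B (fil_mono r h) ⟨z, rfl⟩

/-- The quotient of a flag representation by the first line is a flag representation. -/
theorem IsFlag.quotFil (hr : IsFlag r (n + 1)) : IsFlag (quotFil r 1) n := by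
  have := hr.finite
  have := hr.projective
  have hp := hr.projective_quot
  have hq : ∀ i, Nonempty
      (((E ⧸ fil r 1) ⧸ fil (FlagRep.quotFil r 1) i) ≃ₗ[A] E ⧸ fil r (i + 1)) := by
    intro i
    rw [fil_quotFil]
    exact ⟨Submodule.quotientQuotientEquivQuotient _ _ (fil_mono r (by omega))⟩
  have hpq : ∀ i, Module.Projective A ((E ⧸ fil r 1) ⧸ fil (FlagRep.quotFil r 1) i) := by
    intro i
    obtain ⟨e⟩ := hq i
    exact Module.Projective.of_equiv e.symm
  refine ⟨inferInstance, hp 1, fun t => ?_, hpq, fun i hi t => ?_, ?_⟩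
  · rw [hr.rank_quot (by omega)]
    rfl
  · have h := rankAtStalk_eq_add (fil (FlagRep.quotFil r 1) i) t
    obtain ⟨e⟩ := hq i
    rw [Module.rankAtStalk_eq_of_equiv e, hr.rank_quot (by omega), hr.rank_quot (by omega)] at h
    omega
  · intro B _ _ _ _ i
    have hsurj : Function.Surjective ((fil r 1).mkQ.baseChange B) :=
      LinearMap.lTensor_surjective B (fil r 1).mkQ_surjective
    have h := comap_fil_eq (ψ := (fil r 1).mkQ.baseChange B)
      (by rw [ker_baseChange_mkQ, hr.base_change])
      (baseChange_equivariant B (mkQ_quotFil r 1)) i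
    have h2 := congrArg (Submodule.map ((fil r 1).mkQ.baseChange B)) h
    rw [Submodule.map_comap_eq_of_surjective hsurj, hr.base_change, map_mkQ_baseChange,
      ← fil_quotFil] at h2
    exact h2

theorem StepInjective.baseChange_subFil (hr : IsFlag r n) (B : Type u) [CommRing B] [Algebra k B]
    [Algebra A B] [IsScalarTower k A B] {m : ℕ} (hm : m ≤ n)
    (h : StepInjective (baseChange B r) n) : StepInjective (baseChange B (subFil r m)) m := by
  have := hr.projective_quot m
  refine h.of_injective (baseChange_subtype_injective B (fil r m))
    (baseChange_equivariant B (subtype_subFil r m)) ?_ hm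
  rw [hr.base_change]
  rfl

theorem StepInjective.baseChange_quotFil (hr : IsFlag r (n + 1)) (B : Type u) [CommRing B]
    [Algebra k B] [Algebra A B] [IsScalarTower k A B]
    (h : StepInjective (baseChange B r) (n + 1)) :
    StepInjective (baseChange B (quotFil r 1)) n := by
  refine h.of_surjective (ψ := (fil r 1).mkQ.baseChange B)
    (LinearMap.lTensor_surjective B (fil r 1).mkQ_surjective)
    (by rw [ker_baseChange_mkQ, hr.base_change])
    (baseChange_equivariant B (mkQ_quotFil r 1))

end Flag

/-! ### Flag and wide representations over a field -/

section Field

variable {k : Type u} [Field k] {g : Type v} [LieRing g] [LieAlgebra k g]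
variable {K : Type u} [Field K] [Algebra k K]
variable {V : Type u} [AddCommGroup V] [Module K V]
variable {r : K ⊗[k] g →ₗ⁅K⁆ Module.End K V} {n : ℕ}

/-- Preimage along the surjection onto the abelianization is injective on submodules, so kernels may
be compared on `K ⊗[k] g` itself. -/
theorem constellation_injective_iff :
    Function.Injective (constellation r n) ↔ StepInjective r n := by
  have key : ∀ i j, LinearMap.ker (kappa r i) = LinearMap.ker (kappa r j) ↔
      LinearMap.ker (grMapLin r i) = LinearMap.ker (grMapLin r j) := by
    intro i j
    rw [← comap_ker_kappa, ← comap_ker_kappa]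
    exact (Submodule.comap_injective_of_surjective (Submodule.mkQ_surjective _)).eq_iff.symm
  constructor
  · intro h i j hi hj hij
    have := @h ⟨i, by omega⟩ ⟨j, by omega⟩ ((key i j).2 hij)
    simpa using this
  · intro h i j hij
    exact Fin.ext (h i j (by omega) (by omega) ((key i j).1 hij))

theorem isWide_iff : IsWide r n ↔ IsFieldFlag r n ∧ StepInjective r n := by
  rw [IsWide, constellation_injective_iff]

theorem rankAtStalk_field [FiniteDimensional K V] (t : PrimeSpectrum K) :
    Module.rankAtStalk V t = Module.finrank K V := by
  rw [Module.rankAtStalk_eq_finrank_of_free]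
  simp

theorem IsFlag.isFieldFlag (hr : IsFlag r n) : IsFieldFlag r n := by
  have := hr.finite
  obtain ⟨t⟩ : Nonempty (PrimeSpectrum K) := inferInstance
  exact ⟨hr.finite, by rw [← rankAtStalk_field t, hr.rank_eq],
    fun i hi => by rw [← rankAtStalk_field t, hr.rank_fil i hi]⟩

/-- Over a field the filtration is compatible with base change. -/
theorem fil_baseChange_of_field [FiniteDimensional K V] (B : Type u) [CommRing B] [Algebra k B]
    [Algebra K B] [IsScalarTower k K B] (i : ℕ) :
    fil (baseChange B r) i = (fil r i).baseChange B := by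
  induction i with
  | zero => simp [fil_zero]
  | succ i ih =>
    -- The image of `r` in the finite-dimensional `Module.End K V` is spanned by finitely many
    -- operators. The intersection defining the next step is thus the kernel of one map to a finite
    -- product, and such kernels commute with flat base change.
    obtain ⟨s, hs⟩ : (LinearMap.range (r : K ⊗[k] g →ₗ[K] Module.End K V)).FG :=
      IsNoetherian.noetherian _
    have hmem : ∀ f ∈ s, ∃ v, r v = f := fun f hf => by
      have : f ∈ Submodule.span K (s : Set (Module.End K V)) := Submodule.subset_span hf
      rw [hs] at this
      exact this
    let Φ : V →ₗ[K] (s → V ⧸ fil r i) := LinearMap.pi fun f => (fil r i).mkQ ∘ₗ (f : Module.End K V)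
    have hker : LinearMap.ker Φ = fil r (i + 1) := by
      ext e
      rw [LinearMap.mem_ker, mem_fil_succ]
      constructor
      · intro h v
        have hv : r v ∈ Submodule.span K (s : Set (Module.End K V)) := by
          rw [hs]; exact ⟨v, rfl⟩
        generalize r v = f₀ at hv
        induction hv using Submodule.span_induction with
        | mem f hf =>
          have := congrFun h ⟨f, hf⟩
          simpa [Φ] using this
        | zero => simp
        | add x y _ _ hx hy => exact add_mem hx hy
        | smul a x _ hx => exact Submodule.smul_mem _ a hx
      · intro h
        ext ⟨f, hf⟩
        obtain ⟨v, rfl⟩ := hmem f hf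
        simpa [Φ] using h v
    apply le_antisymm
    · intro z hz
      rw [mem_fil_baseChange_succ, ih] at hz
      have hex := Module.Flat.lTensor_exact B (LinearMap.exact_subtype_ker_map Φ)
      have h0 : Φ.lTensor B z = 0 := by
        classical
        apply (TensorProduct.piRight K K B (fun _ : s => V ⧸ fil r i)).injective
        rw [map_zero]
        ext ⟨f, hf⟩
        obtain ⟨v, rfl⟩ := hmem f hf
        have h1 := hz v
        rw [← ker_baseChange_mkQ, LinearMap.mem_ker, ← LinearMap.comp_apply,
          ← LinearMap.baseChange_comp] at h1
        rw [Pi.zero_apply, ← h1]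
        clear h1 hz
        induction z with
        | zero => simp
        | add x y hx hy => simp only [map_add, Pi.add_apply, hx, hy]
        | tmul b e => simp [Φ]
      rw [hex z] at h0
      rw [← hker]
      exact h0
    · rw [Submodule.baseChange_eq_span, Submodule.span_le]
      rintro _ ⟨e, he, rfl⟩
      rw [SetLike.mem_coe, mem_fil_baseChange_succ, ih]
      intro v
      simpa using Submodule.tmul_mem_baseChange_of_mem (A := B) 1 ((mem_fil_succ r i e).1 he v)

theorem IsFieldFlag.isFlag (hr : IsFieldFlag r n) : IsFlag r n :=
  have := hr.finite
  ⟨hr.finite, inferInstance, fun t => by rw [rankAtStalk_field, hr.finrank_eq],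
    fun i => inferInstance, fun i hi t => by rw [rankAtStalk_field, hr.finrank_fil i hi],
    fun B _ _ _ _ i => fil_baseChange_of_field B i⟩

theorem isFieldFlag_iff_isFlag : IsFieldFlag r n ↔ IsFlag r n :=
  ⟨IsFieldFlag.isFlag, IsFlag.isFieldFlag⟩

/-- A wide representation stays so after a field extension. -/
theorem StepInjective.baseChange_field (hr : IsFieldFlag r n) (h : StepInjective r n)
    (L : Type u) [Field L] [Algebra k L] [Algebra K L] [IsScalarTower k K L] :
    StepInjective (baseChange L r) n := by
  have := hr.finite
  have key : ∀ i (v : K ⊗[k] g), v ∈ LinearMap.ker (grMapLin r i) ↔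
      ∀ z ∈ fil (baseChange L r) (i + 2), (r v).baseChange L z ∈ fil (baseChange L r) i := by
    intro i v
    simp only [mem_ker_grMapLin, fil_baseChange_of_field]
    change fil r (i + 2) ≤ (fil r i).comap (r v) ↔
      (fil r (i + 2)).baseChange L ≤ ((fil r i).baseChange L).comap ((r v).baseChange L)
    rw [← Submodule.map_le_iff_le_comap, ← Submodule.map_le_iff_le_comap, map_mkQ_baseChange,
      Submodule.baseChange_le_iff]
  -- The kernel over K is the preimage of the kernel over L, so equality over L forces equality over
  -- K.
  have key2 : ∀ i (v : K ⊗[k] g), v ∈ LinearMap.ker (grMapLin r i) ↔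
      TensorProduct.map (Algebra.linearMap K L |>.restrictScalars k) LinearMap.id v ∈
        LinearMap.ker (grMapLin (baseChange L r) i) := by
    intro i v
    rw [key, mem_ker_grMapLin]
    have : baseChange L r (TensorProduct.map (Algebra.linearMap K L |>.restrictScalars k)
        LinearMap.id v) = (r v).baseChange L := by
      induction v with
      | zero => simp
      | add x y hx hy => simp only [map_add, hx, hy, LinearMap.baseChange_add]
      | tmul a v =>
        have : a ⊗ₜ[k] v = a • ((1 : K) ⊗ₜ[k] v) := by simp [TensorProduct.smul_tmul']
        rw [TensorProduct.map_tmul, baseChange_tmul, this, map_smul, LinearMap.baseChange_smul]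
        simp
    rw [this]
  intro i j hi hj hij
  refine h i j hi hj (Submodule.ext fun v => ?_)
  rw [key2, key2, hij]

theorem IsWide.subFil (hr : IsWide r n) {m : ℕ} (hm : m ≤ n) : IsWide (subFil r m) m := by
  rw [isWide_iff, isFieldFlag_iff_isFlag] at hr ⊢
  exact ⟨hr.1.subFil hm, hr.2.of_injective (fil r m).subtype_injective (subtype_subFil r m)
    (by simp) hm⟩

theorem IsWide.quotFil (hr : IsWide r (n + 1)) : IsWide (quotFil r 1) n := by
  rw [isWide_iff, isFieldFlag_iff_isFlag] at hr ⊢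
  exact ⟨hr.1.quotFil, hr.2.of_surjective (fil r 1).mkQ_surjective (by simp) (mkQ_quotFil r 1)⟩

end Field

/-! ### Invertible modules and membership tested at primes -/

section Local

variable {A : Type u} [CommRing A]

/-- In an invertible module two elements are proportional. -/
theorem rank_one_proportional {L : Type u} [AddCommGroup L] [Module A L] [Module.Finite A L]
    [Module.Projective A L] (h : ∀ p : PrimeSpectrum A, Module.rankAtStalk L p = 1)
    (ξ : L →ₗ[A] A) (x y : L) : ξ x • y = ξ y • x := by
  rw [← sub_eq_zero]
  refine Module.eq_zero_of_localization_maximal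
    (fun (P : Ideal A) _ => LocalizedModule P.primeCompl L)
    (fun (P : Ideal A) _ => LocalizedModule.mkLinearMap P.primeCompl L) _ fun P hP => ?_
  have hfree : Module.Free (Localization.AtPrime P) (LocalizedModule P.primeCompl L) :=
    Module.free_of_flat_of_isLocalRing
  have hrank : Module.finrank (Localization.AtPrime P) (LocalizedModule P.primeCompl L) = 1 :=
    h ⟨P, hP.isPrime⟩
  let f := LocalizedModule.mkLinearMap P.primeCompl L
  let ξ' : LocalizedModule P.primeCompl L →ₗ[Localization.AtPrime P] Localization.AtPrime P :=
    IsLocalizedModule.mapExtendScalars P.primeCompl f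
      (Algebra.linearMap A (Localization.AtPrime P)) (Localization.AtPrime P) ξ
  have hξ : ∀ u, ξ' (f u) = algebraMap A _ (ξ u) := fun u => by
    simp [ξ', IsLocalizedModule.mapExtendScalars_apply_apply, IsLocalizedModule.map_apply]
  let b := Module.finBasisOfFinrankEq _ _ hrank
  have key : ∀ u w, ξ' u • w = ξ' w • u := by
    intro u w
    rw [← b.sum_repr u, ← b.sum_repr w]
    simp [smul_smul, mul_comm, mul_left_comm]
  have := key (f x) (f y)
  rw [hξ, hξ, algebraMap_smul, algebraMap_smul] at this
  rw [map_sub, map_smul, map_smul]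
  exact sub_eq_zero.2 this

theorem exists_dual_basis (D : Type u) [AddCommGroup D] [Module A D] [Module.Finite A D]
    [Module.Projective A D] :
    ∃ (m : ℕ) (d : Fin m → D) (ε : Fin m → Module.Dual A D), ∀ x, ∑ j, ε j x • d j = x := by
  obtain ⟨m, f, j, hf, hj, hfj⟩ := Module.Finite.exists_comp_eq_id_of_projective A D
  refine ⟨m, fun i => f (Pi.single i 1), fun i => LinearMap.proj i ∘ₗ j, fun x => ?_⟩
  have h1 : f (j x) = x := LinearMap.congr_fun hfj _
  conv_rhs => rw [← h1, ← Finset.univ_sum_single (j x), map_sum]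
  refine Finset.sum_congr rfl fun i _ => ?_
  rw [← map_smul, ← Pi.single_smul, smul_eq_mul, mul_one]
  rfl

/-- A projective module is a summand of a free one; if every coordinate of `x` dies in `L`, then so
does `1 ⊗ x`. -/
theorem exists_functional_of_tmul_ne_zero {P : Type u} [AddCommGroup P] [Module A P]
    [Module.Projective A P] {L : Type u} [Field L] [Algebra A L] {x : P}
    (hx : (1 : L) ⊗ₜ[A] x ≠ 0) : ∃ ξ : P →ₗ[A] A, algebraMap A L (ξ x) ≠ 0 := by
  by_contra! hc
  obtain ⟨s, hs⟩ := Module.Projective.out (R := A) (P := P)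
  apply hx
  rw [← hs x, Finsupp.linearCombination_apply, Finsupp.sum, TensorProduct.tmul_sum]
  refine Finset.sum_eq_zero fun p _ => ?_
  have h := hc (Finsupp.lapply p ∘ₗ s)
  simp only [LinearMap.comp_apply, Finsupp.lapply_apply] at h
  rw [TensorProduct.tmul_smul, ← algebraMap_smul L, h, zero_smul]

/-- The `c` with `c • z ∈ p` form an ideal. If it were proper, a maximal ideal would contain it, and
all such `c` would vanish in that residue field. -/
theorem mem_of_forall_prime {M : Type u} [AddCommGroup M] [Module A M] (p : Submodule A M) (z : M)
    (h : ∀ t : PrimeSpectrum A, ∃ c : A, algebraMap A t.asIdeal.ResidueField c ≠ 0 ∧ c • z ∈ p) :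
    z ∈ p := by
  by_contra hz
  let I : Ideal A := p.comap (LinearMap.toSpanSingleton A M z)
  have hI : I ≠ ⊤ := fun h1 => hz (by
    have : (1 : A) ∈ I := h1 ▸ Submodule.mem_top
    simpa [I] using this)
  obtain ⟨m, hm, hle⟩ := Ideal.exists_le_maximal I hI
  obtain ⟨c, hc, hcz⟩ := h ⟨m, hm.isPrime⟩
  exact hc (Ideal.algebraMap_residueField_eq_zero.2 (hle (by simpa [I] using hcz)))

end Local

/-! ### Extension of linear forms -/

section Eval

variable {A : Type u} [CommRing A] {E : Type u} [AddCommGroup E] [Module A E]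

/-- The extension of a linear form to `B`. -/
noncomputable def ev (B : Type u) [CommRing B] [Algebra A B] (ξ : E →ₗ[A] A) : B ⊗[A] E →ₗ[B] B :=
  (TensorProduct.AlgebraTensorModule.rid A B B).toLinearMap ∘ₗ ξ.baseChange B

@[simp] theorem ev_tmul (B : Type u) [CommRing B] [Algebra A B] (ξ : E →ₗ[A] A) (b : B) (e : E) :
    ev B ξ (b ⊗ₜ e) = ξ e • b := by
  simp [ev]

theorem ev_eq_zero {B : Type u} [CommRing B] [Algebra A B] {ξ : E →ₗ[A] A} {p : Submodule A E}
    (h : ∀ e ∈ p, ξ e = 0) {z : B ⊗[A] E} (hz : z ∈ p.baseChange B) : ev B ξ z = 0 := by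
  have : p.baseChange B ≤ LinearMap.ker (ev B ξ) := by
    rw [Submodule.baseChange_eq_span, Submodule.span_le]
    rintro _ ⟨e, he, rfl⟩
    simp [h e he]
  exact this hz

end Eval

/-! ### Frames at a point and matrix entries of the representation -/

section Frame

variable {k : Type u} [Field k] {g : Type v} [LieRing g] [LieAlgebra k g]
variable {A : Type u} [CommRing A] [Algebra k A]
variable {E : Type u} [AddCommGroup E] [Module A E]
variable {r : A ⊗[k] g →ₗ⁅A⁆ Module.End A E} {n : ℕ}

/-- The form descends to the invertible module E_{i+1}/E_i, where `rank_one_proportional` applies.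
This takes the place of choosing a generator of the line. -/
theorem IsFlag.proportional (hr : IsFlag r n) {i : ℕ} (hi : i < n) {ξ : E →ₗ[A] A}
    (hξ : ∀ e ∈ fil r i, ξ e = 0) {x y : E} (hx : x ∈ fil r (i + 1)) (hy : y ∈ fil r (i + 1)) :
    ξ x • y - ξ y • x ∈ fil r i := by
  have hs := hr.subFil (m := i + 1) hi
  have := hs.finite
  have := hs.projective_quot i
  let η : (fil r (i + 1) ⧸ fil (FlagRep.subFil r (i + 1)) i) →ₗ[A] A :=
    Submodule.liftQ _ (ξ ∘ₗ (fil r (i + 1)).subtype) (by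
      rw [fil_subFil]
      intro e he
      simpa using hξ _ he)
  have h := rank_one_proportional (fun p => by rw [hs.rank_quot (by omega)]; omega) η
    (Submodule.Quotient.mk ⟨x, hx⟩) (Submodule.Quotient.mk ⟨y, hy⟩)
  rw [← Submodule.Quotient.mk_smul, ← Submodule.Quotient.mk_smul, Submodule.Quotient.eq] at h
  have h2 := (fil_subFil r (i + 1) i).le h
  exact h2

theorem IsFlag.proportional_baseChange (hr : IsFlag r n) {i : ℕ} (hi : i < n) {ξ : E →ₗ[A] A}
    (hξ : ∀ e ∈ fil r i, ξ e = 0) {x : E} (hx : x ∈ fil r (i + 1))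
    {B : Type u} [CommRing B] [Algebra A B] {z : B ⊗[A] E} (hz : z ∈ (fil r (i + 1)).baseChange B) :
    ev B ξ z ⊗ₜ[A] x - ξ x • z ∈ (fil r i).baseChange B := by
  rw [Submodule.baseChange_eq_span] at hz
  induction hz using Submodule.span_induction with
  | mem z hz =>
    obtain ⟨y, hy, rfl⟩ := hz
    have h := Submodule.tmul_mem_baseChange_of_mem (A := B) (1 : B) (hr.proportional hi hξ hy hx)
    simpa [TensorProduct.tmul_sub, TensorProduct.smul_tmul] using h
  | zero => simp
  | add z w _ _ hz hw =>
    have := add_mem hz hw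
    rw [map_add, TensorProduct.add_tmul, smul_add, add_sub_add_comm]
    exact this
  | smul b z _ hz =>
    have := Submodule.smul_mem _ b hz
    rw [map_smul, smul_comm (ξ x) b z]
    rwa [smul_sub, TensorProduct.smul_tmul'] at this

/-- Elements `x i` of the steps of the filtration and linear forms `ξ i` which, over `L`,
are bases of the lines and of their duals. -/
structure IsFrame (r : A ⊗[k] g →ₗ⁅A⁆ Module.End A E) (n : ℕ) (L : Type u) [Field L] [Algebra A L]
    (x : ℕ → E) (ξ : ℕ → E →ₗ[A] A) : Prop where
  mem : ∀ i < n, x i ∈ fil r (i + 1)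
  eq_zero : ∀ i < n, ∀ e ∈ fil r i, ξ i e = 0
  ne_zero : ∀ i < n, algebraMap A L (ξ i (x i)) ≠ 0

variable (L : Type u) [Field L] [Algebra k L] [Algebra A L] [IsScalarTower k A L]

theorem IsFlag.baseChange_field (hr : IsFlag r n) : IsFieldFlag (baseChange L r) n := by
  obtain ⟨t⟩ : Nonempty (PrimeSpectrum L) := inferInstance
  have := hr.finite
  have := hr.projective
  refine ⟨inferInstance, ?_, fun i hi => ?_⟩
  · rw [← rankAtStalk_field t, Module.rankAtStalk_baseChange, hr.rank_eq]
  · have := hr.finite_fil i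
    have := hr.projective_fil i
    have := hr.projective_quot i
    have e := LinearEquiv.ofInjective _ (baseChange_subtype_injective L (fil r i))
    rw [hr.base_change, Submodule.baseChange, ← e.finrank_eq, ← rankAtStalk_field t,
      Module.rankAtStalk_baseChange, hr.rank_fil i hi]

/-- Over L the filtration is strictly increasing up to n, so some element of E_{i+1} survives in L ⊗
E/E_i, and a linear form on the projective module E/E_i detects it. -/
theorem IsFlag.exists_frame (hr : IsFlag r n) :
    ∃ (x : ℕ → E) (ξ : ℕ → E →ₗ[A] A), IsFrame r n L x ξ := by
  have key : ∀ i, ∃ (x : E) (ξ : E →ₗ[A] A), i < n → x ∈ fil r (i + 1) ∧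
      (∀ e ∈ fil r i, ξ e = 0) ∧ algebraMap A L (ξ x) ≠ 0 := by
    intro i
    by_cases hi : i < n
    swap
    -- Indices from `n` on carry no condition; zero is a filler.
    · exact ⟨0, 0, fun h => absurd h hi⟩
    have hL := hr.baseChange_field L
    have := hr.projective_quot i
    have hlt : ¬ fil (baseChange L r) (i + 1) ≤ fil (baseChange L r) i := by
      intro h
      have := hL.finite
      have := Submodule.finrank_mono h
      rw [hL.finrank_fil _ hi, hL.finrank_fil _ hi.le] at this
      omega
    rw [hr.base_change, hr.base_change, Submodule.baseChange_eq_span, Submodule.span_le,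
      Set.not_subset] at hlt
    obtain ⟨_, ⟨x, hx, rfl⟩, hxi⟩ := hlt
    rw [SetLike.mem_coe, ← ker_baseChange_mkQ, LinearMap.mem_ker] at hxi
    obtain ⟨ξ, hξ⟩ := exists_functional_of_tmul_ne_zero (x := (fil r i).mkQ x) hxi
    exact ⟨x, ξ ∘ₗ (fil r i).mkQ, fun _ => ⟨hx, fun e he => by
      simp [(Submodule.Quotient.mk_eq_zero (fil r i)).2 he], hξ⟩⟩
  choose x ξ h using key
  exact ⟨x, ξ, fun i hi => (h i hi).1, fun i hi => (h i hi).2.1, fun i hi => (h i hi).2.2⟩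

variable {L} {x : ℕ → E} {ξ : ℕ → E →ₗ[A] A}

theorem IsFrame.mem_fil (hr : IsFlag r n) (hx : IsFrame r n L x ξ) {i : ℕ} (hi : i < n)
    {z : L ⊗[A] E} (hz : z ∈ fil (baseChange L r) (i + 1)) (h0 : ev L (ξ i) z = 0) :
    z ∈ fil (baseChange L r) i := by
  rw [hr.base_change] at hz ⊢
  have h := hr.proportional_baseChange hi (hx.eq_zero i hi) (hx.mem i hi) hz
  rw [h0, TensorProduct.zero_tmul, zero_sub, neg_mem_iff, ← algebraMap_smul L] at h
  exact (Submodule.smul_mem_iff _ (hx.ne_zero i hi)).1 h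

/-- The matrix entry of `v` in position `(i, i + 1)`, over `L`. -/
noncomputable def entry (r : A ⊗[k] g →ₗ⁅A⁆ Module.End A E) (L : Type u) [Field L] [Algebra k L]
    [Algebra A L] [IsScalarTower k A L] (x : E) (ξ : E →ₗ[A] A) : L ⊗[k] g →ₗ[L] L :=
  ev L ξ ∘ₗ LinearMap.applyₗ ((1 : L) ⊗ₜ[A] x) ∘ₗ (baseChange L r : L ⊗[k] g →ₗ[L] _)

theorem entry_apply (x : E) (ξ : E →ₗ[A] A) (v : L ⊗[k] g) :
    entry r L x ξ v = ev L ξ (baseChange L r v (1 ⊗ₜ x)) := rfl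

theorem entry_one_tmul (x : E) (ξ : E →ₗ[A] A) (v : g) :
    entry r L x ξ (1 ⊗ₜ v) = algebraMap A L (ξ (r (1 ⊗ₜ v) x)) := by
  rw [entry_apply, baseChange_one_tmul_one_tmul, ev_tmul, Algebra.algebraMap_eq_smul_one]

/-- Over L the vector `x (i + 1)` spans the source line and `ξ i` is a coordinate on the target
line, so the map of lines vanishes exactly when this one entry does. -/
theorem IsFrame.ker_entry (hr : IsFlag r n) (hx : IsFrame r n L x ξ) {i : ℕ} (hi : i + 1 < n) :
    LinearMap.ker (entry r L (x (i + 1)) (ξ i)) = LinearMap.ker (grMapLin (baseChange L r) i) := by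
  have hmem : (1 : L) ⊗ₜ[A] x (i + 1) ∈ fil (baseChange L r) (i + 2) := by
    rw [hr.base_change]
    exact Submodule.tmul_mem_baseChange_of_mem _ (hx.mem _ hi)
  ext v
  rw [mem_ker_grMapLin, LinearMap.mem_ker, entry_apply]
  constructor
  · intro h e he
    have h1 := hx.mem_fil hr (by omega) ((mem_fil_succ _ _ _).1 hmem v) h
    have he' := he
    rw [hr.base_change] at he'
    have h2 := hr.proportional_baseChange hi (hx.eq_zero _ hi) (hx.mem _ hi) he'
    rw [← hr.base_change] at h2
    have h3 := (mem_fil_succ _ _ _).1 h2 v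
    rw [map_sub, ← mul_one (ev L _ e), ← smul_eq_mul, ← TensorProduct.smul_tmul', map_smul,
      ← algebraMap_smul L (ξ (i + 1) (x (i + 1))), map_smul] at h3
    have h4 := sub_mem (Submodule.smul_mem _ (ev L (ξ (i + 1)) e) h1) h3
    rw [sub_sub_cancel] at h4
    exact (Submodule.smul_mem_iff _ (hx.ne_zero _ hi)).1 h4
  · intro h
    have h1 := h _ hmem
    rw [hr.base_change] at h1
    exact ev_eq_zero (hx.eq_zero i (by omega)) h1

/-- A zero entry would put `x (i + 1)` one step lower in the filtration over L, where `ξ (i + 1)`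
vanishes. This is the surjectivity of κ onto its line. -/
theorem IsFrame.entry_ne_zero (hr : IsFlag r n) (hx : IsFrame r n L x ξ) {i : ℕ} (hi : i + 1 < n) :
    entry r L (x (i + 1)) (ξ i) ≠ 0 := by
  intro h
  have hk := hx.ker_entry hr hi
  rw [h, LinearMap.ker_zero] at hk
  have hmem : (1 : L) ⊗ₜ[A] x (i + 1) ∈ fil (baseChange L r) (i + 2) := by
    rw [hr.base_change]
    exact Submodule.tmul_mem_baseChange_of_mem _ (hx.mem _ hi)
  have h1 : (1 : L) ⊗ₜ[A] x (i + 1) ∈ fil (baseChange L r) (i + 1) := by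
    rw [mem_fil_succ]
    intro v
    have : v ∈ LinearMap.ker (grMapLin (baseChange L r) i) := hk ▸ Submodule.mem_top
    exact mem_ker_grMapLin.1 this _ hmem
  rw [hr.base_change] at h1
  have h2 := ev_eq_zero (hx.eq_zero _ hi) h1
  rw [ev_tmul, ← Algebra.algebraMap_eq_smul_one] at h2
  exact hx.ne_zero _ hi h2

theorem IsFrame.exists_entry_ne_zero (hr : IsFlag r n) (hx : IsFrame r n L x ξ) {i : ℕ}
    (hi : i + 1 < n) : ∃ v : A ⊗[k] g, algebraMap A L (ξ i (r v (x (i + 1)))) ≠ 0 := by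
  by_contra! h
  refine hx.entry_ne_zero hr hi (TensorProduct.AlgebraTensorModule.ext fun c v => ?_)
  have : c ⊗ₜ[k] v = c • ((1 : L) ⊗ₜ[k] v) := by simp [TensorProduct.smul_tmul']
  rw [this, map_smul, entry_one_tmul, h]
  simp

/-- Two distinct points of the constellation have a nonzero minor. -/
theorem IsFrame.exists_minor_ne_zero (hr : IsFlag r n) (hx : IsFrame r n L x ξ) {i j : ℕ}
    (hi : i + 1 < n) (hj : j + 1 < n)
    (hij : LinearMap.ker (grMapLin (baseChange L r) i) ≠
      LinearMap.ker (grMapLin (baseChange L r) j)) :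
    ∃ v w : A ⊗[k] g, algebraMap A L (ξ i (r v (x (i + 1))) * ξ j (r w (x (j + 1))) -
      ξ i (r w (x (i + 1))) * ξ j (r v (x (j + 1)))) ≠ 0 := by
  by_contra! h
  rw [← hx.ker_entry hr hi, ← hx.ker_entry hr hj] at hij
  have hφ := hx.entry_ne_zero hr hi
  have hψ := hx.entry_ne_zero hr hj
  set φ := entry r L (x (i + 1)) (ξ i)
  set ψ := entry r L (x (j + 1)) (ξ j)
  -- The vanishing of all minors says that the bilinear form φ(v)ψ(w) is symmetric, which may be
  -- checked on elements `1 ⊗ v`. Nonzero forms with this property have the same kernel.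
  have hbil : (LinearMap.mul L L).compl₁₂ φ ψ = ((LinearMap.mul L L).compl₁₂ φ ψ).flip := by
    refine TensorProduct.AlgebraTensorModule.ext fun c v => ?_
    refine TensorProduct.AlgebraTensorModule.ext fun d w => ?_
    have hc : ∀ (c : L) (v : g), c ⊗ₜ[k] v = c • ((1 : L) ⊗ₜ[k] v) := by
      simp [TensorProduct.smul_tmul']
    have h1 := h (1 ⊗ₜ v) (1 ⊗ₜ w)
    rw [map_sub, sub_eq_zero, map_mul, map_mul] at h1
    simp only [← entry_one_tmul] at h1
    rw [hc c, hc d]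
    rw [LinearMap.map_smul, LinearMap.map_smul, LinearMap.map_smul, LinearMap.map_smul]
    simp only [LinearMap.smul_apply, LinearMap.compl₁₂_apply, LinearMap.flip_apply,
      LinearMap.mul_apply', smul_eq_mul]
    linear_combination c * d * h1
  have hmul : ∀ v w, φ v * ψ w = φ w * ψ v := fun v w =>
    LinearMap.congr_fun (LinearMap.congr_fun hbil v) w
  obtain ⟨w, hw⟩ : ∃ w, φ w ≠ 0 := by
    by_contra! h; exact hφ (LinearMap.ext h)
  obtain ⟨w', hw'⟩ : ∃ w, ψ w ≠ 0 := by
    by_contra! h; exact hψ (LinearMap.ext h)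
  refine hij (Submodule.ext fun v => ?_)
  rw [LinearMap.mem_ker, LinearMap.mem_ker]
  constructor
  · intro hv
    have := hmul v w
    rw [hv, zero_mul] at this
    exact (mul_eq_zero.1 this.symm).resolve_left hw
  · intro hv
    have := hmul v w'
    rw [hv, mul_zero] at this
    exact (mul_eq_zero.1 this).resolve_right hw'

end Frame

/-! ### Endomorphisms with values in an A-algebra -/

section Endo

variable {k : Type u} [Field k] {g : Type v} [LieRing g] [LieAlgebra k g]
variable {A : Type u} [CommRing A] [Algebra k A]
variable {E : Type u} [AddCommGroup E] [Module A E]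
variable {r : A ⊗[k] g →ₗ⁅A⁆ Module.End A E} {n : ℕ}
variable {B : Type u} [CommRing B] [Algebra A B]

/-- `a` is the restriction to `E` of an endomorphism of the base change of `r` to `B`. -/
def IsValuedEndo (r : A ⊗[k] g →ₗ⁅A⁆ Module.End A E) (a : E →ₗ[A] B ⊗[A] E) : Prop :=
  ∀ v e, a (r v e) = (r v).baseChange B (a e)

/-- The scalar `b`, as an endomorphism with values in `B`. -/
noncomputable def scalar (E : Type u) [AddCommGroup E] [Module A E] (b : B) :
    E →ₗ[A] B ⊗[A] E := TensorProduct.mk A B E b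

@[simp] theorem scalar_apply (b : B) (e : E) : scalar E b e = b ⊗ₜ[A] e := rfl

theorem IsValuedEndo.sub_scalar {a : E →ₗ[A] B ⊗[A] E} (ha : IsValuedEndo r a) (b : B) :
    IsValuedEndo r (a - scalar E b) := by
  intro v e
  simp [ha v e]

/-- At each prime, evaluating `ξ i` on `b ⊗ x i` shows that `b` is killed by an element not
vanishing there. This serves to compare scalars acting on the same line. -/
theorem tmul_left_injective (hr : IsFlag r n) {i : ℕ} (hi : i < n) {b : B}
    (h : ∀ e ∈ fil r (i + 1), b ⊗ₜ[A] e ∈ (fil r i).baseChange B) : b = 0 := by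
  rw [← Submodule.mem_bot A]
  refine mem_of_forall_prime _ _ fun t => ?_
  obtain ⟨x, ξ, hx⟩ := hr.exists_frame t.asIdeal.ResidueField
  refine ⟨_, hx.ne_zero i hi, ?_⟩
  have := ev_eq_zero (hx.eq_zero i hi) (h _ (hx.mem i hi))
  rwa [ev_tmul] at this

theorem mem_baseChange_of_forall_prime (p : Submodule A E) (z : B ⊗[A] E)
    (h : ∀ t : PrimeSpectrum A, ∃ c : A, algebraMap A t.asIdeal.ResidueField c ≠ 0 ∧
      c • z ∈ p.baseChange B) : z ∈ p.baseChange B :=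
  mem_of_forall_prime ((p.baseChange B).restrictScalars A) z h

/-- Modulo the first line, `ξ 1 (x 1) • a y` is the `ξ 1`-coordinate of `a y` times `x 1`, and `c`
kills that coordinate. -/
theorem IsValuedEndo.smul_mem (hr : IsFlag r n) (hn : 2 ≤ n) {a : E →ₗ[A] B ⊗[A] E}
    {L : Type u} [Field L] [Algebra A L] {x : ℕ → E}
    {ξ : ℕ → E →ₗ[A] A} (hx : IsFrame r n L x ξ) {y : E} (hy : a y ∈ (fil r 2).baseChange B)
    {c : A} (hc : c • ev B (ξ 1) (a y) = 0) :
    (c * ξ 1 (x 1)) • a y ∈ (fil r 1).baseChange B := by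
  have h := hr.proportional_baseChange (B := B) (i := 1) hn (hx.eq_zero 1 hn) (hx.mem 1 hn) hy
  have h2 := Submodule.smul_of_tower_mem _ c h
  rwa [smul_sub, TensorProduct.smul_tmul', hc, TensorProduct.zero_tmul, zero_sub, neg_mem_iff,
    smul_smul] at h2

variable [Algebra k B] [IsScalarTower k A B]

theorem IsFlag.mem_baseChange_succ (hr : IsFlag r n) (i : ℕ) (z : B ⊗[A] E) :
    z ∈ (fil r (i + 1)).baseChange B ↔
      ∀ v : A ⊗[k] g, (r v).baseChange B z ∈ (fil r i).baseChange B := by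
  rw [← hr.base_change, ← hr.base_change, mem_fil_baseChange_succ]

theorem IsFlag.mem_baseChange_one (hr : IsFlag r n) (z : B ⊗[A] E) :
    z ∈ (fil r 1).baseChange B ↔ ∀ v : A ⊗[k] g, (r v).baseChange B z = 0 := by
  simp [hr.mem_baseChange_succ, fil_zero]

theorem IsValuedEndo.mem (hr : IsFlag r n) {a : E →ₗ[A] B ⊗[A] E} (ha : IsValuedEndo r a) {i : ℕ}
    {e : E} (he : e ∈ fil r i) : a e ∈ (fil r i).baseChange B := by
  induction i generalizing e with
  | zero =>
    rw [fil_zero, Submodule.mem_bot] at he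
    simp [he]
  | succ i ih =>
    rw [hr.mem_baseChange_succ]
    intro v
    rw [← ha]
    exact ih ((mem_fil_succ _ _ _).1 he v)

/-- On the first line an endomorphism is a scalar. -/
theorem IsValuedEndo.exists_scalar (hr : IsFlag r (n + 1)) {a : E →ₗ[A] B ⊗[A] E}
    (ha : IsValuedEndo r a) : ∃ b : B, ∀ e ∈ fil r 1, a e = b ⊗ₜ e := by
  have := hr.finite_fil 1
  have := hr.projective_quot 1
  have := hr.projective_fil 1
  obtain ⟨π, hπ⟩ := exists_projection (fil r 1)
  obtain ⟨m, d, ε, hd⟩ := exists_dual_basis (A := A) (fil r 1)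
  -- The scalar is the trace of `a` on the first line, written with a dual basis.
  refine ⟨∑ i, ev B (ε i ∘ₗ π) (a (d i)), fun e he => ?_⟩
  have hsum : ∑ i, ε i (π e) • (d i : E) = e := by
    rw [hπ ⟨e, he⟩]
    simpa using congrArg Subtype.val (hd ⟨e, he⟩)
  rw [TensorProduct.sum_tmul]
  conv_lhs => rw [← hsum, map_sum]
  refine Finset.sum_congr rfl fun i _ => ?_
  have h := hr.proportional_baseChange (B := B) (i := 0) (by omega) (ξ := ε i ∘ₗ π)
    (by simp [fil_zero]) he (ha.mem hr (d i).2)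
  rw [fil_zero, Submodule.baseChange_bot, Submodule.mem_bot, sub_eq_zero] at h
  rw [h, map_smul]
  rfl

/-- The basic relation between the entries of an endomorphism and those of the representation. -/
theorem IsValuedEndo.entry_relation (hr : IsFlag r n) (hn : 2 ≤ n) {a : E →ₗ[A] B ⊗[A] E}
    (ha : IsValuedEndo r a) {L : Type u} [Field L] [Algebra A L] {x : ℕ → E}
    {ξ : ℕ → E →ₗ[A] A} (hx : IsFrame r n L x ξ) {y : E} (hy : a y ∈ (fil r 2).baseChange B)
    (v : A ⊗[k] g) :
    ξ 0 (r v (x 1)) • ev B (ξ 1) (a y) = ξ 1 (x 1) • ev B (ξ 0) (a (r v y)) := by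
  have h := hr.proportional_baseChange (B := B) (i := 1) hn (hx.eq_zero 1 hn) (hx.mem 1 hn) hy
  -- Applying `v` kills the error term in the first line, and equivariance turns `v (a y)` into `a
  -- (v y)`.
  have h1 := (hr.mem_baseChange_one _).1 h v
  rw [map_sub, sub_eq_zero, LinearMap.baseChange_tmul, LinearMap.map_smul_of_tower, ← ha] at h1
  have h2 := congrArg (ev B (ξ 0)) h1
  rwa [ev_tmul, LinearMap.map_smul_of_tower] at h2

/-- The right side of `entry_relation` vanishes because `v` maps E into E_1. At each prime some `v`
has nonzero entry, which kills the diagonal entry of `a` on the second line. -/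
theorem IsValuedEndo.rank_two (hr : IsFlag r 2) {a : E →ₗ[A] B ⊗[A] E}
    (ha : IsValuedEndo r a) (h1 : ∀ e ∈ fil r 1, a e = 0) (e : E) :
    a e ∈ (fil r 1).baseChange B := by
  refine mem_baseChange_of_forall_prime _ _ fun t => ?_
  obtain ⟨x, ξ, hx⟩ := hr.exists_frame t.asIdeal.ResidueField
  obtain ⟨v, hv⟩ := hx.exists_entry_ne_zero hr (i := 0) (by omega)
  have hmem : ∀ e, e ∈ fil r 2 := fun e => by rw [hr.fil_eq_top le_rfl]; trivial
  have hy := ha.mem hr (hmem e)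
  refine ⟨_, ?_, smul_mem hr le_rfl hx hy (c := ξ 0 (r v (x 1))) ?_⟩
  · rw [map_mul]
    exact mul_ne_zero hv (hx.ne_zero 1 (by omega))
  · rw [ha.entry_relation hr le_rfl hx hy, h1 _ ((mem_fil_succ _ _ _).1 (hmem e) v)]
    simp

/-- If the first and the last point of the constellation differ in each fibre, an endomorphism
concentrated in the two last upper diagonals is concentrated in the last one. -/
theorem IsValuedEndo.cancel {m : ℕ} (hr : IsFlag r (m + 3))
    (hw : ∀ t : PrimeSpectrum A, LinearMap.ker (grMapLin (fiber r t) 0) ≠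
      LinearMap.ker (grMapLin (fiber r t) (m + 1))) {a : E →ₗ[A] B ⊗[A] E}
    (ha : IsValuedEndo r a) (h1 : ∀ e ∈ fil r (m + 1), a e = 0)
    (h2 : ∀ e ∈ fil r (m + 2), a e ∈ (fil r 1).baseChange B)
    (h3 : ∀ e, a e ∈ (fil r 2).baseChange B) :
    (∀ e, a e ∈ (fil r 1).baseChange B) ∧ ∀ e ∈ fil r (m + 2), a e = 0 := by
  have htop : ∀ e, e ∈ fil r (m + 3) := fun e => by rw [hr.fil_eq_top le_rfl]; trivial
  have hdown : ∀ v e, r v e ∈ fil r (m + 2) := fun v e => (mem_fil_succ _ _ _).1 (htop e) v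
  have first : ∀ e, a e ∈ (fil r 1).baseChange B := by
    intro e
    refine mem_baseChange_of_forall_prime _ _ fun t => ?_
    obtain ⟨x, ξ, hx⟩ := hr.exists_frame t.asIdeal.ResidueField
    obtain ⟨v, w, hvw⟩ := hx.exists_minor_ne_zero hr (by omega) (by omega) (hw t)
    have hz := h3 (x (m + 2))
    -- On E_{m+2} the map `a` factors through the single line E_{m+2}/E_{m+1}.
    have hprop : ∀ v w, ξ (m + 1) (r w (x (m + 2))) • a (r v (x (m + 2))) =
        ξ (m + 1) (r v (x (m + 2))) • a (r w (x (m + 2))) := by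
      intro v w
      have h := h1 _ (hr.proportional (i := m + 1) (by omega) (hx.eq_zero _ (by omega))
        (hdown w (x (m + 2))) (hdown v (x (m + 2))))
      rwa [map_sub, map_smul, map_smul, sub_eq_zero] at h
    -- The entry relations for `v` and `w`, combined with `hprop`, show that the minor of the first
    -- and last points kills the entry of `a` from the last line to the second.
    obtain ⟨δ, hδ0, hδ⟩ : ∃ δ : A, algebraMap A t.asIdeal.ResidueField δ ≠ 0 ∧
        δ • ev B (ξ 1) (a (x (m + 2))) = 0 := by
      refine ⟨_, hvw, ?_⟩
      have hv := ha.entry_relation hr (by omega) hx hz v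
      have hw := ha.entry_relation hr (by omega) hx hz w
      have hp := congrArg (ev B (ξ 0)) (hprop v w)
      rw [LinearMap.map_smul_of_tower, LinearMap.map_smul_of_tower] at hp
      rw [sub_smul, mul_comm, mul_comm (ξ 0 (r w (x 1))), mul_smul, mul_smul, hv, hw,
        smul_comm, hp, smul_comm, sub_self]
    have hx1 := smul_mem hr (by omega) hx hz hδ
    -- The last factor passes from `x (m + 2)` to an arbitrary `e`: the two are proportional modulo
    -- E_{m+2}, which `a` already maps into the first line.
    refine ⟨(δ * ξ 1 (x 1)) * ξ (m + 2) (x (m + 2)), ?_, ?_⟩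
    rotate_left
    · have h := h2 _ (hr.proportional (i := m + 2) (by omega) (hx.eq_zero _ (by omega))
        (hx.mem (m + 2) (by omega)) (htop e))
      rw [map_sub, map_smul, map_smul] at h
      have h' := Submodule.smul_of_tower_mem _ (δ * ξ 1 (x 1)) h
      rw [smul_sub, smul_smul, smul_comm] at h'
      exact (Submodule.sub_mem_iff_left _ (Submodule.smul_of_tower_mem _ _ hx1)).1 h'
    · rw [map_mul, map_mul]
      exact mul_ne_zero (mul_ne_zero hδ0 (hx.ne_zero 1 (by omega))) (hx.ne_zero _ (by omega))
  refine ⟨first, fun e he => ?_⟩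
  rw [← Submodule.mem_bot A]
  refine mem_of_forall_prime _ _ fun t => ?_
  obtain ⟨x, ξ, hx⟩ := hr.exists_frame t.asIdeal.ResidueField
  -- Since `a` now lands in the first line, `w` after `a` is zero, hence so is `a` after `w`; a
  -- nonzero last entry of `w` makes it reach E_{m+2}/E_{m+1}.
  obtain ⟨w, hw⟩ := hx.exists_entry_ne_zero hr (i := m + 1) (by omega)
  refine ⟨_, hw, ?_⟩
  have h := h1 _ (hr.proportional (i := m + 1) (by omega) (hx.eq_zero _ (by omega))
    (hdown w (x (m + 2))) he)
  rw [map_sub, map_smul, map_smul, ha, (hr.mem_baseChange_one _).1 (first _), smul_zero,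
    sub_zero] at h
  rw [h]
  exact Submodule.zero_mem _

theorem IsValuedEndo.exists_subFil (hr : IsFlag r n) {a : E →ₗ[A] B ⊗[A] E}
    (ha : IsValuedEndo r a) (i : ℕ) :
    ∃ a' : fil r i →ₗ[A] B ⊗[A] fil r i, IsValuedEndo (subFil r i) a' ∧
      ∀ e, (fil r i).subtype.baseChange B (a' e) = a e := by
  have := hr.projective_quot i
  have hinj := baseChange_subtype_injective B (fil r i)
  obtain ⟨π, hπ⟩ := exists_projection (fil r i)
  have hπ' : ∀ z ∈ (fil r i).baseChange B,
      (fil r i).subtype.baseChange B (π.baseChange B z) = z := by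
    rintro _ ⟨z, rfl⟩
    congr 1
    rw [← LinearMap.comp_apply, ← LinearMap.baseChange_comp,
      show π ∘ₗ (fil r i).subtype = LinearMap.id from LinearMap.ext hπ, LinearMap.baseChange_id]
    rfl
  have hcomp : ∀ e : fil r i, (fil r i).subtype.baseChange B (π.baseChange B (a e)) = a e :=
    fun e => hπ' _ (ha.mem hr e.2)
  refine ⟨(π.baseChange B).restrictScalars A ∘ₗ a ∘ₗ (fil r i).subtype, ?_, hcomp⟩
  intro v e
  apply hinj
  have h1 := hcomp (subFil r i v e)
  have h2 : ∀ z, (fil r i).subtype.baseChange B ((subFil r i v).baseChange B z) =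
      (r v).baseChange B ((fil r i).subtype.baseChange B z) := by
    intro z
    simp only [← LinearMap.comp_apply, ← LinearMap.baseChange_comp]
    rfl
  rw [h2]
  refine h1.trans (Eq.trans (ha v e) ?_)
  congr 1
  exact (hcomp e).symm

theorem IsValuedEndo.exists_quotFil (hr : IsFlag r n) {a : E →ₗ[A] B ⊗[A] E}
    (ha : IsValuedEndo r a) :
    ∃ a' : E ⧸ fil r 1 →ₗ[A] B ⊗[A] (E ⧸ fil r 1), IsValuedEndo (quotFil r 1) a' ∧
      ∀ e, a' ((fil r 1).mkQ e) = (fil r 1).mkQ.baseChange B (a e) := by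
  refine ⟨Submodule.liftQ _ (((fil r 1).mkQ.baseChange B).restrictScalars A ∘ₗ a) ?_, ?_,
    fun e => rfl⟩
  · intro e he
    have := ha.mem hr he
    rw [← ker_baseChange_mkQ] at this
    exact this
  · intro v e
    obtain ⟨e, rfl⟩ := (fil r 1).mkQ_surjective e
    change (fil r 1).mkQ.baseChange B (a (r v e)) =
      (quotFil r 1 v).baseChange B ((fil r 1).mkQ.baseChange B (a e))
    rw [ha]
    simp only [← LinearMap.comp_apply, ← LinearMap.baseChange_comp]
    rfl

/-- The endomorphisms of a representation with wide fibres: scalars, plus maps from the last line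
to the first one. -/
theorem IsValuedEndo.exists_scalar_of_wide {m : ℕ} (hr : IsFlag r (m + 2))
    (hw : ∀ t : PrimeSpectrum A, StepInjective (fiber r t) (m + 2)) {a : E →ₗ[A] B ⊗[A] E}
    (ha : IsValuedEndo r a) :
    ∃ b : B, (∀ e ∈ fil r (m + 1), a e = b ⊗ₜ e) ∧
      ∀ e, a e - b ⊗ₜ e ∈ (fil r 1).baseChange B := by
  induction m generalizing E with
  | zero =>
    obtain ⟨b, hb⟩ := ha.exists_scalar hr
    exact ⟨b, hb, (ha.sub_scalar b).rank_two hr fun e he => by simp [hb e he]⟩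
  | succ m ih =>
    obtain ⟨a', ha', haa'⟩ := ha.exists_subFil hr (m + 2)
    obtain ⟨a'', ha'', haa''⟩ := ha.exists_quotFil hr
    obtain ⟨b, hb1, hb2⟩ := ih (hr.subFil (by omega))
      (fun t => StepInjective.baseChange_subFil hr _ (by omega) (hw t)) ha'
    obtain ⟨b', hb1', hb2'⟩ := ih hr.quotFil
      (fun t => StepInjective.baseChange_quotFil hr _ (hw t)) ha''
    have s1 : ∀ e ∈ fil r (m + 1), a e = b ⊗ₜ e := by
      intro e he
      have he2 := fil_mono r (by omega : m + 1 ≤ m + 2) he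
      have h := hb1 ⟨e, he2⟩ (by rw [fil_subFil]; exact he)
      have h' := haa' ⟨e, he2⟩
      rw [h] at h'
      simpa using h'.symm
    have s2 : ∀ e ∈ fil r (m + 2), a e - b ⊗ₜ e ∈ (fil r 1).baseChange B := by
      intro e he
      have h := hb2 ⟨e, he⟩
      have := hr.projective_quot (m + 2)
      have hc := fil_eq_comap (baseChange_subtype_injective B (fil r (m + 2)))
        (baseChange_equivariant B (subtype_subFil r (m + 2))) 1
      rw [← (hr.subFil (by omega)).base_change, hc, hr.base_change, Submodule.mem_comap, map_sub,
        haa', LinearMap.baseChange_tmul] at h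
      exact h
    have q : ∀ e i, (fil r 1).mkQ.baseChange B (a e - b' ⊗ₜ e) ∈
        (fil (FlagRep.quotFil r 1) i).baseChange B → a e - b' ⊗ₜ e ∈ (fil r (i + 1)).baseChange B := by
      intro e i h
      have hc := comap_fil_eq (ψ := (fil r 1).mkQ.baseChange B)
        (by rw [ker_baseChange_mkQ, hr.base_change])
        (baseChange_equivariant B (mkQ_quotFil r 1)) i
      rw [← hr.base_change, ← hc, hr.quotFil.base_change]
      exact h
    have q1 : ∀ e ∈ fil r (m + 2), a e - b' ⊗ₜ e ∈ (fil r 1).baseChange B := by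
      intro e he
      refine q e 0 ?_
      have h := hb1' ((fil r 1).mkQ e) (by rw [fil_quotFil]; exact ⟨e, he, rfl⟩)
      rw [map_sub, ← haa'', h]
      simp
    have q2 : ∀ e, a e - b' ⊗ₜ e ∈ (fil r 2).baseChange B := by
      intro e
      refine q e 1 ?_
      have h := hb2' ((fil r 1).mkQ e)
      rw [haa''] at h
      simpa using h
    -- The line E_2/E_1 belongs both to the subrepresentation and to the quotient, and `a` acts on
    -- it by either scalar.
    have hbb : b - b' = 0 := by
      refine tmul_left_injective hr (i := 1) (by omega) fun e he => ?_
      have he2 := fil_mono r (by omega : 2 ≤ m + 2) he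
      have := sub_mem (q1 e he2) (s2 e he2)
      rwa [sub_sub_sub_cancel_left, ← TensorProduct.sub_tmul] at this
    obtain rfl : b = b' := sub_eq_zero.1 hbb
    obtain ⟨c1, c2⟩ := (ha.sub_scalar b).cancel hr
      (fun t h => by simpa using hw t 0 (m + 1) (by omega) (by omega) h)
      (fun e he => by simp [s1 e he]) s2 q2
    refine ⟨b, fun e he => ?_, c1⟩
    have := c2 e he
    rwa [LinearMap.sub_apply, sub_eq_zero] at this

end Endo

/-! ### The coordinate ring of the multiplicative group times a vector group -/

section UnitRing

open LaurentPolynomial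

variable (A : Type u) [CommRing A] (M : Type u) [AddCommGroup M] [Module A M]

/-- The `A`-algebra whose points are pairs of a unit and a linear form on `M`. -/
abbrev UnitRing : Type u := LaurentPolynomial (SymmetricAlgebra A M)

/-- The universal linear form. -/
noncomputable def unitRingι : M →ₗ[A] UnitRing A M :=
  (Algebra.linearMap (SymmetricAlgebra A M) (UnitRing A M)).restrictScalars A ∘ₗ
    SymmetricAlgebra.ι A M

variable {A M}

theorem exists_unitRing_hom {B : Type u} [CommRing B] [Algebra A B] (b : Bˣ) (φ : M →ₗ[A] B) :
    ∃ f : UnitRing A M →ₐ[A] B, f (T 1) = b ∧ ∀ m, f (unitRingι A M m) = φ m := by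
  have hC : ∀ s : SymmetricAlgebra A M, LaurentPolynomial.eval₂
      (SymmetricAlgebra.lift φ).toRingHom b (algebraMap _ (UnitRing A M) s) =
        SymmetricAlgebra.lift φ s := fun s => by
    rw [← LaurentPolynomial.C_eq_algebraMap, eval₂_C]; rfl
  refine ⟨{ LaurentPolynomial.eval₂ (SymmetricAlgebra.lift φ).toRingHom b with
    commutes' := fun a => ?_ }, ?_, fun m => ?_⟩
  · refine (congrArg _ (IsScalarTower.algebraMap_apply A (SymmetricAlgebra A M)
      (UnitRing A M) a)).trans ((hC _).trans ?_)
    simp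
  · refine (eval₂_T _ _ 1).trans ?_
    simp
  · exact (hC _).trans (SymmetricAlgebra.lift_ι_apply ..)

theorem unitRing_hom_ext {B : Type u} [CommRing B] [Algebra A B] {f f' : UnitRing A M →ₐ[A] B}
    (h1 : f (T 1) = f' (T 1)) (h2 : ∀ m, f (unitRingι A M m) = f' (unitRingι A M m)) : f = f' := by
  have hC : ∀ s, f (C s) = f' (C s) := by
    intro s
    have : f.comp (IsScalarTower.toAlgHom A (SymmetricAlgebra A M) (UnitRing A M)) =
        f'.comp (IsScalarTower.toAlgHom A (SymmetricAlgebra A M) (UnitRing A M)) :=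
      SymmetricAlgebra.algHom_ext (LinearMap.ext h2)
    exact DFunLike.congr_fun this s
  have hinv : f (T (-1)) = f' (T (-1)) := by
    have h : (T 1 : UnitRing A M) * T (-1) = 1 := by rw [← T_add]; simp
    have hf := congrArg f h
    have hf' := congrArg f' h
    rw [map_mul, map_one] at hf hf'
    exact left_inv_eq_right_inv ((mul_comm _ _).trans hf) (h1 ▸ hf')
  refine AlgHom.ext fun p => ?_
  induction p using LaurentPolynomial.induction_on with
  | h_C a => exact hC a
  | h_add hp hq => rw [map_add, map_add, hp, hq]
  | h_C_mul_T n a h => rw [T_add, ← mul_assoc, map_mul, h, h1, map_mul f' (_ * _)]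
  | h_C_mul_T_Z n a h =>
    rw [sub_eq_add_neg, T_add, ← mul_assoc, map_mul, h, hinv, map_mul f' (_ * _)]

/-- A retraction of a free module onto `M` induces one of a polynomial ring onto the symmetric
algebra. -/
theorem projective_symmetricAlgebra [Module.Projective A M] :
    Module.Projective A (SymmetricAlgebra A M) := by
  obtain ⟨s, hs⟩ := Module.Projective.out (R := A) (P := M)
  let p : (M →₀ A) →ₗ[A] M := Finsupp.linearCombination A id
  let i' := SymmetricAlgebra.lift (SymmetricAlgebra.ι A (M →₀ A) ∘ₗ s)
  let p' := SymmetricAlgebra.lift (SymmetricAlgebra.ι A M ∘ₗ p)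
  refine Module.Projective.of_split i'.toLinearMap p'.toLinearMap ?_
  have : p'.comp i' = AlgHom.id A _ := by
    refine SymmetricAlgebra.algHom_ext (LinearMap.ext fun m => ?_)
    simp [i', p', SymmetricAlgebra.lift_ι_apply, p, hs m]
  exact LinearMap.ext fun x => DFunLike.congr_fun this x

theorem flat_unitRing [Module.Projective A M] : Module.Flat A (UnitRing A M) := by
  have := projective_symmetricAlgebra (A := A) (M := M)
  exact Module.Flat.trans A (SymmetricAlgebra A M) _

theorem ringKrullDim_le_of_isLocalization {R S : Type u} [CommRing R] [CommRing S] [Algebra R S]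
    (N : Submonoid R) [IsLocalization N S] : ringKrullDim S ≤ ringKrullDim R :=
  Order.krullDim_le_of_strictMono (PrimeSpectrum.comap (algebraMap R S))
    (Monotone.strictMono_of_injective (fun _ _ h => Ideal.comap_mono h)
      (PrimeSpectrum.localization_comap_injective S N))

/-- The symmetric algebra of a line is K[X]. Adjoining T gives dimension 2, and inverting T does not
raise it. -/
theorem ringKrullDim_unitRing_le {K : Type u} [Field K] {M : Type u} [AddCommGroup M] [Module K M]
    (h : Module.finrank K M = 1) : ringKrullDim (UnitRing K M) ≤ 2 := by
  have : Module.Finite K M := Module.finite_of_finrank_pos (by omega)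
  let e := (SymmetricAlgebra.equivMvPolynomial (Module.finBasisOfFinrankEq K M h)).toRingEquiv
  have : IsNoetherianRing (SymmetricAlgebra K M) := isNoetherianRing_of_ringEquiv _ e.symm
  refine (ringKrullDim_le_of_isLocalization
    (Submonoid.powers (Polynomial.X : Polynomial (SymmetricAlgebra K M)))).trans ?_
  rw [Polynomial.ringKrullDim_of_isNoetherianRing, ringKrullDim_eq_of_ringEquiv e,
    MvPolynomial.ringKrullDim_of_isNoetherianRing, ringKrullDim_eq_zero_of_field]
  norm_num

end UnitRing

/-! ### Automorphisms as endomorphisms with values in B -/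

section Automorphisms

variable {A : Type u} [CommRing A] {E : Type u} [AddCommGroup E] [Module A E]
variable {B : Type u} [CommRing B] [Algebra A B]

/-- A unit plus a nilpotent endomorphism is an automorphism. -/
theorem exists_equiv_of_nilpotent (b : Bˣ) {h : E →ₗ[A] B ⊗[A] E}
    (hn : IsNilpotent (h.liftBaseChange B : Module.End B (B ⊗[A] E))) :
    ∃ α : (B ⊗[A] E) ≃ₗ[B] (B ⊗[A] E), ∀ e, α (1 ⊗ₜ e) = (b : B) ⊗ₜ e + h e := by
  have hb : IsUnit (algebraMap B (Module.End B (B ⊗[A] E)) b) := b.isUnit.map _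
  have hu := hn.isUnit_add_left_of_commute hb (Algebra.commutes _ _).symm
  refine ⟨LinearEquiv.ofBijective _ ((Module.End.isUnit_iff _).1 hu), fun e => ?_⟩
  simp [TensorProduct.smul_tmul']

variable {k : Type u} [Field k] {g : Type v} [LieRing g] [LieAlgebra k g] [Algebra k A]
variable [Algebra k B] [IsScalarTower k A B]
variable {r : A ⊗[k] g →ₗ⁅A⁆ Module.End A E}

theorem isAut_of_isValuedEndo {α : (B ⊗[A] E) ≃ₗ[B] (B ⊗[A] E)} {a : E →ₗ[A] B ⊗[A] E}
    (h : ∀ e, α (1 ⊗ₜ e) = a e) (ha : IsValuedEndo r a) : IsAut (baseChange B r) α := by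
  have key : ∀ (v : A ⊗[k] g) z, α ((r v).baseChange B z) = (r v).baseChange B (α z) := by
    intro v z
    induction z with
    | zero => simp
    | add x y hx hy => simp only [map_add, hx, hy]
    | tmul c e =>
      have hc : ∀ e : E, c ⊗ₜ[A] e = c • ((1 : B) ⊗ₜ[A] e) := by simp [TensorProduct.smul_tmul']
      rw [LinearMap.baseChange_tmul, hc e, hc, map_smul, map_smul, map_smul, h, h, ha]
  intro v z
  induction v with
  | zero => simp
  | add x y hx hy => simp only [map_add, LinearMap.add_apply, hx, hy]
  | tmul b v => simp only [baseChange_tmul, LinearMap.smul_apply, map_smul, key]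

/-- The restriction of an automorphism of `B ⊗ E` to `E`. -/
noncomputable def restrictEquiv (α : (B ⊗[A] E) ≃ₗ[B] (B ⊗[A] E)) : E →ₗ[A] B ⊗[A] E :=
  (α.toLinearMap.restrictScalars A) ∘ₗ TensorProduct.mk A B E 1

@[simp] theorem restrictEquiv_apply (α : (B ⊗[A] E) ≃ₗ[B] (B ⊗[A] E)) (e : E) :
    restrictEquiv α e = α (1 ⊗ₜ e) := rfl

theorem IsAut.isValuedEndo {α : (B ⊗[A] E) ≃ₗ[B] (B ⊗[A] E)} (h : IsAut (baseChange B r) α) :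
    IsValuedEndo r (restrictEquiv α) := by
  intro v e
  induction v with
  | zero => simp
  | add x y hx hy => simp only [map_add, LinearMap.add_apply, hx, hy, LinearMap.baseChange_add]
  | tmul a v =>
    have hc : a ⊗ₜ[k] v = a • ((1 : A) ⊗ₜ[k] v) := by simp [TensorProduct.smul_tmul']
    have h1 := h (1 ⊗ₜ v) (1 ⊗ₜ e)
    rw [baseChange_tmul, one_smul, LinearMap.baseChange_tmul] at h1
    rw [hc, map_smul, LinearMap.smul_apply, LinearMap.baseChange_smul, LinearMap.smul_apply,
      map_smul, restrictEquiv_apply, restrictEquiv_apply, h1]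

theorem IsAut.symm {α : (B ⊗[A] E) ≃ₗ[B] (B ⊗[A] E)} (h : IsAut (baseChange B r) α) :
    IsAut (baseChange B r) α.symm := by
  intro v e
  rw [LinearEquiv.symm_apply_eq, h]
  simp

end Automorphisms

/-! ### Maps E/P → D as linear forms on (E/P) ⊗ D^∨ -/

section Universal

variable {A : Type u} [CommRing A] {E : Type u} [AddCommGroup E] [Module A E]
variable (D P : Submodule A E) {m : ℕ} (d : Fin m → D) (ε : Fin m → Module.Dual A D)

/-- The map `E → E / P → B ⊗ D → B ⊗ E` attached to a linear form on `(E / P) ⊗ Dual D`, in terms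
of a dual basis of `D`. -/
noncomputable def lastToFirst {B : Type u} [CommRing B] [Algebra A B]
    (φ : (E ⧸ P) ⊗[A] Module.Dual A D →ₗ[A] B) : E →ₗ[A] B ⊗[A] E :=
  ∑ j, (TensorProduct.mk A B E).flip (d j : E) ∘ₗ φ ∘ₗ
    (TensorProduct.mk A (E ⧸ P) (Module.Dual A D)).flip (ε j) ∘ₗ P.mkQ

variable {D P d ε}
variable {B : Type u} [CommRing B] [Algebra A B]

theorem lastToFirst_apply (φ : (E ⧸ P) ⊗[A] Module.Dual A D →ₗ[A] B) (e : E) :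
    lastToFirst D P d ε φ e = ∑ j, φ (P.mkQ e ⊗ₜ ε j) ⊗ₜ[A] (d j : E) := by
  simp [lastToFirst]

theorem lastToFirst_eq_zero (φ : (E ⧸ P) ⊗[A] Module.Dual A D →ₗ[A] B) {e : E} (he : e ∈ P) :
    lastToFirst D P d ε φ e = 0 := by
  simp [lastToFirst_apply, (Submodule.Quotient.mk_eq_zero P).2 he]

theorem lastToFirst_mem (φ : (E ⧸ P) ⊗[A] Module.Dual A D →ₗ[A] B) (e : E) :
    lastToFirst D P d ε φ e ∈ D.baseChange B := by
  rw [lastToFirst_apply]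
  exact sum_mem fun j _ => Submodule.tmul_mem_baseChange_of_mem _ (d j).2

theorem rTensor_lastToFirst {R : Type u} [CommRing R] [Algebra A R] (f : R →ₐ[A] B)
    (φ : (E ⧸ P) ⊗[A] Module.Dual A D →ₗ[A] R) (e : E) :
    f.toLinearMap.rTensor E (lastToFirst D P d ε φ e) =
      lastToFirst D P d ε (f.toLinearMap ∘ₗ φ) e := by
  simp [lastToFirst_apply]

theorem liftBaseChange_mul_self_eq_zero {h : E →ₗ[A] B ⊗[A] E} (hDP : D ≤ P)
    (h0 : ∀ e ∈ P, h e = 0) (h1 : ∀ e, h e ∈ D.baseChange B) :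
    (h.liftBaseChange B : Module.End B (B ⊗[A] E)) ^ 2 = 0 := by
  have hD : D.baseChange B ≤ LinearMap.ker (h.liftBaseChange B) := by
    rw [Submodule.baseChange_eq_span, Submodule.span_le]
    rintro _ ⟨e, he, rfl⟩
    simp [h0 e (hDP he)]
  refine TensorProduct.AlgebraTensorModule.ext fun b e => ?_
  rw [pow_two, Module.End.mul_apply, LinearMap.liftBaseChange_tmul, map_smul]
  simp [LinearMap.mem_ker.1 (hD (h1 e))]

/-- The form pairs `h e` with functionals on `D`, extended to `E` through `π`; the dual basis
expansion rebuilds `h` from these values. -/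
theorem exists_lastToFirst {π : E →ₗ[A] D} (hπ : ∀ x : D, π x = x)
    (hd : ∀ x : D, ∑ j, ε j x • d j = x) {h : E →ₗ[A] B ⊗[A] E}
    (h0 : ∀ e ∈ P, h e = 0) (h1 : ∀ e, h e ∈ D.baseChange B) :
    ∃ φ : (E ⧸ P) ⊗[A] Module.Dual A D →ₗ[A] B, lastToFirst D P d ε φ = h := by
  let Φ : E →ₗ[A] Module.Dual A D →ₗ[A] B := LinearMap.mk₂ A
    (fun e η => ev B (η ∘ₗ π) (h e)) (fun x y η => by simp) (fun c x η => by
      rw [map_smul, LinearMap.map_smul_of_tower])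
    (fun e η η' => by
      generalize h e = z
      induction z with
      | zero => simp
      | add x y hx hy => simp only [map_add, hx, hy]; ring
      | tmul b e => simp [add_smul]) (fun c e η => by
      generalize h e = z
      induction z with
      | zero => simp
      | add x y hx hy => simp only [map_add, hx, hy, smul_add]
      | tmul b e => simp [mul_smul])
  refine ⟨TensorProduct.lift (P.liftQ Φ fun e he => ?_), LinearMap.ext fun e => ?_⟩
  · rw [LinearMap.mem_ker]
    ext η
    simp [Φ, h0 e he]
  · rw [lastToFirst_apply]
    change ∑ j, ev B (ε j ∘ₗ π) (h e) ⊗ₜ[A] (d j : E) = h e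
    have hz := h1 e
    rw [Submodule.baseChange_eq_span] at hz
    generalize h e = z at hz
    induction hz using Submodule.span_induction with
    | mem z hz =>
      obtain ⟨x, hx, rfl⟩ := hz
      have h2 := hd ⟨x, hx⟩
      have h3 : π x = ⟨x, hx⟩ := hπ ⟨x, hx⟩
      conv_rhs => rw [TensorProduct.mk_apply, show x = ((⟨x, hx⟩ : D) : E) from rfl, ← h2]
      simp [h3, TensorProduct.tmul_sum, TensorProduct.smul_tmul]
    | zero => simp
    | add z w _ _ hz hw => simp only [map_add, TensorProduct.add_tmul, Finset.sum_add_distrib, hz, hw]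
    | smul b z _ hz =>
      conv_rhs => rw [← hz]
      rw [Finset.smul_sum]
      refine Finset.sum_congr rfl fun j _ => ?_
      rw [map_smul, TensorProduct.smul_tmul']

theorem lastToFirst_injective (hd : ∀ x : D, ∑ j, ε j x • d j = x) {π : E →ₗ[A] D}
    (hπ : ∀ x : D, π x = x) :
    Function.Injective (lastToFirst D P d ε (B := B)) := by
  intro φ φ' h
  refine TensorProduct.ext' fun q η => ?_
  obtain ⟨e, rfl⟩ := P.mkQ_surjective q
  have hη : η = ∑ j, η (d j) • ε j := by
    ext x
    conv_lhs => rw [← hd x, map_sum]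
    simp [mul_comm]
  have key : ∀ φ : (E ⧸ P) ⊗[A] Module.Dual A D →ₗ[A] B,
      ev B (η ∘ₗ π) (lastToFirst D P d ε φ e) = φ (P.mkQ e ⊗ₜ η) := by
    intro φ
    rw [lastToFirst_apply, map_sum]
    conv_rhs => rw [hη, TensorProduct.tmul_sum, map_sum]
    simp [hπ]
  rw [← key, ← key, h]

end Universal

/-! ### The universal automorphism -/

section AutRing

variable {k : Type u} [Field k] {g : Type v} [LieRing g] [LieAlgebra k g]
variable {A : Type u} [CommRing A] [Algebra k A]
variable {E : Type u} [AddCommGroup E] [Module A E]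
variable {r : A ⊗[k] g →ₗ⁅A⁆ Module.End A E} {n : ℕ}

/-- If all endomorphisms of `r` are scalars up to maps from `E / P` to the first line, then
`Aut r` is the product of the multiplicative group and a vector group. -/
theorem isAutRing_unitRing (hr : IsFlag r (n + 1)) (P : Submodule A E) (hP : fil r 1 ≤ P)
    (hrP : ∀ v e, r v e ∈ P)
    (hend : ∀ (B : Type u) [CommRing B] [Algebra k B] [Algebra A B] [IsScalarTower k A B]
      (a : E →ₗ[A] B ⊗[A] E), IsValuedEndo r a →
      ∃ b : B, (∀ e ∈ P, a e = b ⊗ₜ e) ∧ ∀ e, a e - b ⊗ₜ e ∈ (fil r 1).baseChange B)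
    [Algebra k (UnitRing A ((E ⧸ P) ⊗[A] Module.Dual A (fil r 1)))]
    [IsScalarTower k A (UnitRing A ((E ⧸ P) ⊗[A] Module.Dual A (fil r 1)))] :
    IsAutRing r (UnitRing A ((E ⧸ P) ⊗[A] Module.Dual A (fil r 1))) := by
  have := hr.finite_fil 1
  have := hr.projective_fil 1
  have := hr.projective_quot 1
  obtain ⟨m, d, ε, hd⟩ := exists_dual_basis (A := A) (fil r 1)
  obtain ⟨π, hπ⟩ := exists_projection (fil r 1)
  -- A map killing P and landing in the first line commutes with `r` because both composites are
  -- zero.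
  have hendo : ∀ {B : Type u} [CommRing B] [Algebra k B] [Algebra A B] [IsScalarTower k A B]
      (φ : (E ⧸ P) ⊗[A] Module.Dual A (fil r 1) →ₗ[A] B) (b : B),
      IsValuedEndo r (scalar E b + lastToFirst _ P d ε φ) := by
    intro B _ _ _ _ φ b v e
    rw [LinearMap.add_apply, LinearMap.add_apply, map_add, lastToFirst_eq_zero φ (hrP v e),
      (hr.mem_baseChange_one _).1 (lastToFirst_mem φ e) v]
    simp
  set M := (E ⧸ P) ⊗[A] Module.Dual A (fil r 1)
  have hunit : ∀ {B : Type u} [CommRing B] [Algebra A B] (φ : M →ₗ[A] B) (b : Bˣ),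
      ∃ α : (B ⊗[A] E) ≃ₗ[B] (B ⊗[A] E),
        ∀ e, α (1 ⊗ₜ e) = (b : B) ⊗ₜ e + lastToFirst _ P d ε φ e := fun φ b =>
    exists_equiv_of_nilpotent b ⟨2, liftBaseChange_mul_self_eq_zero hP
      (fun e he => lastToFirst_eq_zero φ he) (lastToFirst_mem φ)⟩
  let τ : (UnitRing A M)ˣ := (LaurentPolynomial.isUnit_T 1).unit
  have hτ : (τ : UnitRing A M) = LaurentPolynomial.T 1 := rfl
  obtain ⟨u, hu⟩ := hunit (unitRingι A M) τ
  refine ⟨u, isAut_of_isValuedEndo hu (hendo _ _), ?_⟩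
  intro B _ _ _ _ α hα
  obtain ⟨b, hb1, hb2⟩ := hend B _ hα.isValuedEndo
  obtain ⟨b', hb1', hb2'⟩ := hend B _ hα.symm.isValuedEndo
  -- The scalar of the inverse automorphism inverts the scalar of `α`, as seen on the first line.
  have hbb : b * b' = 1 := by
    rw [← sub_eq_zero]
    refine tmul_left_injective hr (i := 0) (by omega) fun e he => ?_
    have h1 := hb1 e (hP he)
    have h2 := hb1' e (hP he)
    rw [restrictEquiv_apply] at h1 h2
    have h3 := α.symm_apply_apply (1 ⊗ₜ e)
    rw [h1, ← mul_one b, ← smul_eq_mul, ← TensorProduct.smul_tmul', map_smul, h2,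
      TensorProduct.smul_tmul', smul_eq_mul] at h3
    rw [TensorProduct.sub_tmul, h3, sub_self]
    exact zero_mem _
  let b₀ : Bˣ := ⟨b, b', hbb, by rw [mul_comm, hbb]⟩
  obtain ⟨φ, hφ⟩ := exists_lastToFirst (P := P) hπ hd (h := restrictEquiv α - scalar E b)
    (fun e he => by simp [hb1 e he]) hb2
  have hαφ : ∀ e, α (1 ⊗ₜ e) = b ⊗ₜ e + lastToFirst _ P d ε φ e := fun e => by simp [hφ]
  have hf : ∀ (f : UnitRing A M →ₐ[A] B) e, f.toLinearMap.rTensor E (u (1 ⊗ₜ e)) =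
      f (LaurentPolynomial.T 1) ⊗ₜ e +
        lastToFirst _ P d ε (f.toLinearMap ∘ₗ unitRingι A M) e := by
    intro f e
    rw [hu, map_add, rTensor_lastToFirst, LinearMap.rTensor_tmul, hτ]
    rfl
  obtain ⟨f, hfT, hfι⟩ := exists_unitRing_hom b₀ φ
  refine ⟨f, fun e => ?_, fun f' hf' => ?_⟩
  · rw [hf, hfT, hαφ, show f.toLinearMap ∘ₗ unitRingι A M = φ from LinearMap.ext hfι]
  -- For uniqueness, the unit is read off on the first line and the linear form from what remains.
  · have hT : f' (LaurentPolynomial.T 1) = b := by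
      rw [eq_comm, ← sub_eq_zero]
      refine tmul_left_injective hr (i := 0) (by omega) fun e he => ?_
      have h := hf' e
      rw [hf, hαφ, lastToFirst_eq_zero _ (hP he), lastToFirst_eq_zero _ (hP he), add_zero,
        add_zero] at h
      rw [TensorProduct.sub_tmul, h, sub_self]
      exact zero_mem _
    have hι : f'.toLinearMap ∘ₗ unitRingι A M = φ := by
      refine lastToFirst_injective (P := P) hd hπ (LinearMap.ext fun e => ?_)
      have h := hf' e
      rw [hf, hαφ, hT, add_right_inj] at h
      exact h.symm
    refine unitRing_hom_ext (by rw [hT, hfT]) fun m => ?_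
    rw [hfι]
    exact LinearMap.congr_fun hι m

end AutRing

/-! ### Flatness of Aut r -/

section Flat

variable {k : Type u} [Field k] {g : Type v} [LieRing g] [LieAlgebra k g]
variable {A : Type u} [CommRing A] [Algebra k A]
variable {E : Type u} [AddCommGroup E] [Module A E]
variable {r : A ⊗[k] g →ₗ⁅A⁆ Module.End A E} {n : ℕ}

theorem isAutRing_self_of_subsingleton [Subsingleton E] : IsAutRing r A := by
  have hs : ∀ (B : Type u) [CommRing B] [Algebra A B] (z w : B ⊗[A] E), z = w := fun B _ _ z w => by
    have : ∀ z : B ⊗[A] E, z = 0 := fun z => by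
      induction z with
      | zero => rfl
      | add x y hx hy => rw [hx, hy, add_zero]
      | tmul b e => rw [Subsingleton.elim e 0, TensorProduct.tmul_zero]
    rw [this z, this w]
  refine ⟨LinearEquiv.refl _ _, fun v e => hs _ _ _, fun B _ _ _ _ α _ =>
    ⟨Algebra.ofId A B, fun e => hs _ _ _, fun f _ => Subsingleton.elim _ _⟩⟩

theorem IsFlag.autFlat_of_end (hr : IsFlag r (n + 1)) (P : Submodule A E) (hP : fil r 1 ≤ P)
    [Module.Projective A (E ⧸ P)] (hrP : ∀ v e, r v e ∈ P)
    (hend : ∀ (B : Type u) [CommRing B] [Algebra k B] [Algebra A B] [IsScalarTower k A B]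
      (a : E →ₗ[A] B ⊗[A] E), IsValuedEndo r a →
      ∃ b : B, (∀ e ∈ P, a e = b ⊗ₜ e) ∧ ∀ e, a e - b ⊗ₜ e ∈ (fil r 1).baseChange B) :
    AutFlat r := by
  have := hr.finite_fil 1
  have := hr.projective_fil 1
  let : Algebra k (UnitRing A ((E ⧸ P) ⊗[A] Module.Dual A (fil r 1))) :=
    ((algebraMap A _).comp (algebraMap k A)).toAlgebra
  have : IsScalarTower k A (UnitRing A ((E ⧸ P) ⊗[A] Module.Dual A (fil r 1))) :=
    .of_algebraMap_eq' rfl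
  exact ⟨UnitRing A ((E ⧸ P) ⊗[A] Module.Dual A (fil r 1)), inferInstance, inferInstance,
    inferInstance, inferInstance, isAutRing_unitRing hr P hP hrP hend, flat_unitRing⟩

/-- A flag representation with wide fibres has a flat automorphism group scheme. -/
theorem IsFlag.autFlat (hr : IsFlag r n)
    (hw : ∀ t : PrimeSpectrum A, StepInjective (fiber r t) n) : AutFlat r := by
  match n with
  | 0 =>
    have : Subsingleton E := by
      have h := hr.fil_eq_top le_rfl
      rw [fil_zero] at h
      exact (Submodule.subsingleton_iff A).1 (subsingleton_of_bot_eq_top h)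
    exact ⟨A, inferInstance, inferInstance, inferInstance, inferInstance,
      isAutRing_self_of_subsingleton, inferInstance⟩
  | 1 =>
    -- In rank one the vector group is trivial: taking P to be everything makes E/P zero, and only
    -- scalars remain.
    refine hr.autFlat_of_end ⊤ le_top (fun _ _ => trivial) fun B _ _ _ _ a ha => ?_
    obtain ⟨b, hb⟩ := ha.exists_scalar hr
    have h : ∀ e, a e = b ⊗ₜ e := fun e => hb e (by rw [hr.fil_eq_top le_rfl]; trivial)
    exact ⟨b, fun e _ => h e, fun e => by rw [h, sub_self]; exact zero_mem _⟩
  | m + 2 =>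
    have := hr.projective_quot (m + 1)
    refine hr.autFlat_of_end (fil r (m + 1)) (fil_mono r (by omega))
      (fun v e => (mem_fil_succ _ _ _).1 (by rw [hr.fil_eq_top le_rfl]; trivial) v)
      fun B _ _ _ _ a ha => ha.exists_scalar_of_wide hr hw

end Flat

/-! ### Bounds for dim Aut r -/

section Dimension

variable {k : Type u} [Field k] {g : Type v} [LieRing g] [LieAlgebra k g]
variable {K : Type u} [Field K] [Algebra k K]
variable {V : Type u} [AddCommGroup V] [Module K V]
variable {r : K ⊗[k] g →ₗ⁅K⁆ Module.End K V} {n : ℕ}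

/-- The explicit coordinate ring enters the infimum defining `autDim`; its vector group comes from a
line, as both V/V_{n+1} and V_1 are lines. -/
theorem IsWide.autDim_le (hr : IsWide r (n + 2)) : autDim r ≤ 2 := by
  rw [isWide_iff] at hr
  obtain ⟨hf, hw⟩ := hr
  have hr := hf.isFlag
  have := hf.finite
  let : Algebra k (UnitRing K ((V ⧸ fil r (n + 1)) ⊗[K] Module.Dual K (fil r 1))) :=
    ((algebraMap K _).comp (algebraMap k K)).toAlgebra
  have : IsScalarTower k K (UnitRing K ((V ⧸ fil r (n + 1)) ⊗[K] Module.Dual K (fil r 1))) :=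
    .of_algebraMap_eq' rfl
  have haut : IsAutRing r (UnitRing K ((V ⧸ fil r (n + 1)) ⊗[K] Module.Dual K (fil r 1))) :=
    isAutRing_unitRing hr (fil r (n + 1)) (fil_mono r (by omega))
      (fun v e => (mem_fil_succ _ _ _).1 (by rw [hr.fil_eq_top le_rfl]; trivial) v)
      fun B _ _ _ _ a ha => ha.exists_scalar_of_wide hr (fun t => hw.baseChange_field hf _)
  refine (sInf_le ⟨_, _, _, _, ‹_›, haut, rfl⟩ : autDim r ≤ _).trans (ringKrullDim_unitRing_le ?_)
  have h := Submodule.finrank_quotient_add_finrank (fil r (n + 1))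
  rw [hf.finrank_eq, hf.finrank_fil _ (by omega)] at h
  rw [Module.finrank_tensorProduct, Subspace.dual_finrank_eq, hf.finrank_fil _ (by omega)]
  omega

/-- The coordinate ring of the product of the multiplicative group and an affine space. -/
abbrev TorusPoly (K : Type u) [Field K] (m : ℕ) : Type u :=
  MvPolynomial (Fin m) (LaurentPolynomial K)

/-- The zero ideal lies strictly inside the kernel of evaluation at T = 1. -/
theorem one_le_ringKrullDim_laurentPolynomial (K : Type u) [Field K] :
    1 ≤ ringKrullDim (LaurentPolynomial K) := by
  refine Order.one_le_krullDim_iff.2 ?_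
  let f : LaurentPolynomial K →+* K := LaurentPolynomial.eval₂ (RingHom.id K) 1
  have : IsDomain (LaurentPolynomial K) :=
    IsLocalization.isDomain_of_le_nonZeroDivisors (M := Submonoid.powers (Polynomial.X : Polynomial K))
      _ (Submonoid.powers_le.2 (mem_nonZeroDivisors_of_ne_zero Polynomial.X_ne_zero))
  refine ⟨⟨⊥, Ideal.isPrime_bot⟩, ⟨RingHom.ker f, RingHom.ker_isPrime f⟩, ?_⟩
  change (⊥ : Ideal _) < RingHom.ker f
  rw [bot_lt_iff_ne_bot, Submodule.ne_bot_iff]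
  refine ⟨LaurentPolynomial.T 1 - 1, ?_, fun h => ?_⟩
  · rw [RingHom.mem_ker, map_sub, LaurentPolynomial.eval₂_T]
    simp
  · have h2 := congrArg (fun p => p.coeff 1)
      ((sub_eq_zero.1 h).trans LaurentPolynomial.T_zero.symm)
    simp only [LaurentPolynomial.T_apply] at h2
    norm_num at h2

theorem le_ringKrullDim_torusPoly (K : Type u) [Field K] (m : ℕ) :
    1 + m ≤ ringKrullDim (TorusPoly K m) := by
  refine le_trans ?_ (ringKrullDim_add_natCard_le_ringKrullDim_mvPolynomial (R := LaurentPolynomial K) (Fin m))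
  simpa using add_le_add_left (one_le_ringKrullDim_laurentPolynomial K) (m : WithBot ℕ∞)

theorem torusPoly_subalgebra_eq_top {m : ℕ} (S : Subalgebra K (TorusPoly K m))
    (hT : MvPolynomial.C (LaurentPolynomial.T 1) ∈ S)
    (hT' : MvPolynomial.C (LaurentPolynomial.T (-1)) ∈ S) (hX : ∀ i, MvPolynomial.X i ∈ S) :
    S = ⊤ := by
  rw [eq_top_iff]
  rintro p -
  induction p using MvPolynomial.induction_on with
  | C a =>
    induction a using LaurentPolynomial.induction_on with
    | h_C a => exact S.algebraMap_mem a
    | h_add hp hq => rw [map_add]; exact S.add_mem hp hq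
    | h_C_mul_T n a h => rw [LaurentPolynomial.T_add, ← mul_assoc, map_mul]; exact S.mul_mem h hT
    | h_C_mul_T_Z n a h =>
      rw [sub_eq_add_neg, LaurentPolynomial.T_add, ← mul_assoc, map_mul]; exact S.mul_mem h hT'
  | add p q hp hq => exact S.add_mem hp hq
  | mul_X p i hp => exact S.mul_mem hp (hX i)

theorem ev_rTensor {A B R : Type u} [CommRing A] [CommRing B] [CommRing R] [Algebra A B]
    [Algebra A R] {E : Type u} [AddCommGroup E] [Module A E] (f : R →ₐ[A] B) (ζ : E →ₗ[A] A)
    (z : R ⊗[A] E) : ev B ζ (f.toLinearMap.rTensor E z) = f (ev R ζ z) := by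
  induction z with
  | zero => simp
  | add x y hx hy => simp only [map_add, hx, hy]
  | tmul b e => simp

theorem equiv_rTensor {A B R : Type u} [CommRing A] [CommRing B] [CommRing R] [Algebra A B]
    [Algebra A R] {E : Type u} [AddCommGroup E] [Module A E] {f : R →ₐ[A] B}
    {u : (R ⊗[A] E) ≃ₗ[R] (R ⊗[A] E)} {α : (B ⊗[A] E) ≃ₗ[B] (B ⊗[A] E)}
    (h : ∀ e : E, α (1 ⊗ₜ e) = f.toLinearMap.rTensor E (u (1 ⊗ₜ e))) (z : R ⊗[A] E) :
    α (f.toLinearMap.rTensor E z) = f.toLinearMap.rTensor E (u z) := by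
  induction z with
  | zero => simp
  | add x y hx hy => simp only [map_add, hx, hy]
  | tmul b e =>
    have h1 : ∀ w, f.toLinearMap.rTensor E (b • w) = f b • f.toLinearMap.rTensor E w := by
      intro w
      induction w with
      | zero => simp
      | add x y hx hy => simp only [smul_add, map_add, hx, hy]
      | tmul c e => simp [TensorProduct.smul_tmul']
    have h2 : b ⊗ₜ[A] e = b • ((1 : R) ⊗ₜ[A] e) := by simp [TensorProduct.smul_tmul']
    rw [h2, h1, map_smul, map_smul, h1, ← h]
    simp

/-- Linearly independent endomorphisms lowering the filtration bound `dim Aut r` from below. -/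
theorem le_ringKrullDim_of_isAutRing {R : Type u} [CommRing R] [Algebra k R] [Algebra K R]
    [IsScalarTower k K R] (hR : IsAutRing r R) (hn : fil r n = ⊤) {m : ℕ}
    (h : Fin m → V →ₗ[K] V) (hcomm : ∀ i v e, h i (r v e) = r v (h i e))
    (hlow : ∀ i j, ∀ e ∈ fil r (j + 1), h i e ∈ fil r j)
    {e₀ : V} (he₀ : e₀ ∈ fil r 1) {ζ₀ : V →ₗ[K] K} (hζ₀ : ζ₀ e₀ = 1)
    (y : Fin m → V) (ζ : Fin m → V →ₗ[K] K)
    (hζ : ∀ i j, ζ i (h j (y i)) = if i = j then 1 else 0) :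
    1 + m ≤ ringKrullDim R := by
  obtain ⟨u, -, hu⟩ := hR
  let B := TorusPoly K m
  let τ : Bˣ := ((LaurentPolynomial.isUnit_T (R := K) 1).map MvPolynomial.C).unit
  have hτ : (τ : B) = MvPolynomial.C (LaurentPolynomial.T 1) := rfl
  have hτ' : MvPolynomial.C (LaurentPolynomial.T (-1)) * (τ : B) = 1 := by
    rw [hτ, ← map_mul, ← LaurentPolynomial.T_add]
    simp
  -- The automorphism T + ∑ X_i h_i exists over B because H lowers the filtration and so is
  -- nilpotent. Its matrix coefficients lie in the range of the classifying map R → B. With T⁻¹ they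
  -- generate B, so R surjects onto a ring of dimension at least 1 + m.
  let H : V →ₗ[K] B ⊗[K] V := ∑ i, (TensorProduct.mk K B V (MvPolynomial.X i)) ∘ₗ h i
  have hH : ∀ e, H e = ∑ i, (MvPolynomial.X i : B) ⊗ₜ[K] h i e := fun e => by simp [H]
  have hlow' : ∀ j, (fil r (j + 1)).baseChange B ≤
      ((fil r j).baseChange B).comap (H.liftBaseChange B) := by
    intro j
    rw [Submodule.baseChange_eq_span, Submodule.span_le]
    rintro _ ⟨e, he, rfl⟩
    simp only [TensorProduct.mk_apply, SetLike.mem_coe, Submodule.mem_comap,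
      LinearMap.liftBaseChange_tmul, one_smul, hH]
    exact sum_mem fun i _ => Submodule.tmul_mem_baseChange_of_mem _ (hlow i j e he)
  have hpow : ∀ j, ∀ z ∈ (fil r j).baseChange B,
      ((H.liftBaseChange B : Module.End B (B ⊗[K] V)) ^ j) z = 0 := by
    intro j
    induction j with
    | zero => simp [fil_zero]
    | succ j ih =>
      intro z hz
      rw [pow_succ, Module.End.mul_apply]
      exact ih _ (hlow' j hz)
  obtain ⟨α, hα⟩ := exists_equiv_of_nilpotent τ (h := H)
    ⟨n, LinearMap.ext fun z => hpow n z (by rw [hn, Submodule.baseChange_top]; trivial)⟩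
  have haut : IsAut (baseChange B r) α := by
    refine isAut_of_isValuedEndo (a := scalar V (τ : B) + H) hα fun v e => ?_
    simp [hH, hcomm]
  obtain ⟨f, hf, -⟩ := hu B α haut
  have hmem : ∀ e (ζ : V →ₗ[K] K), ev B ζ (α (1 ⊗ₜ e)) ∈ f.range := fun e ζ => by
    rw [hf, ev_rTensor]
    exact ⟨_, rfl⟩
  have hev : ∀ e (ζ : V →ₗ[K] K), ev B ζ (α (1 ⊗ₜ e)) =
      ζ e • (τ : B) + ∑ i, ζ (h i e) • (MvPolynomial.X i : B) := fun e ζ => by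
    rw [hα, map_add, hH, map_sum]
    simp
  have h0 : ∀ i, h i e₀ = 0 := fun i => by simpa [fil_zero] using hlow i 0 e₀ he₀
  have hT : (τ : B) ∈ f.range := by
    have := hmem e₀ ζ₀
    rw [hev] at this
    simpa [hζ₀, h0] using this
  -- T⁻¹ is obtained as a coefficient of the inverse automorphism, hence comes from `u.symm`.
  have hT' : MvPolynomial.C (LaurentPolynomial.T (-1)) ∈ f.range := by
    refine ⟨ev R ζ₀ (u.symm (1 ⊗ₜ e₀)), ?_⟩
    change f _ = _
    rw [← ev_rTensor]
    have h1 := equiv_rTensor hf (u.symm (1 ⊗ₜ e₀))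
    rw [LinearEquiv.apply_symm_apply, LinearMap.rTensor_tmul, AlgHom.toLinearMap_apply, map_one,
      ← LinearEquiv.eq_symm_apply] at h1
    have h2 : α.symm (1 ⊗ₜ e₀) =
        (MvPolynomial.C (LaurentPolynomial.T (-1)) : B) • ((1 : B) ⊗ₜ[K] e₀) := by
      rw [LinearEquiv.symm_apply_eq, map_smul, hα, hH]
      simp [h0, TensorProduct.smul_tmul', hτ']
    rw [h1, h2, map_smul, ev_tmul, hζ₀]
    simp
  have hX : ∀ i, MvPolynomial.X i ∈ f.range := by
    intro i
    have h1 := hmem (y i) (ζ i)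
    rw [hev] at h1
    have h2 := f.range.sub_mem h1 (f.range.smul_mem hT (ζ i (y i)))
    rw [add_sub_cancel_left] at h2
    simpa [hζ] using h2
  have hsurj : Function.Surjective f := by
    rw [← AlgHom.range_eq_top]
    exact torusPoly_subalgebra_eq_top _ hT hT' hX
  exact (le_ringKrullDim_torusPoly K m).trans (ringKrullDim_le_of_surjective f.toRingHom hsurj)

end Dimension

/-! ### Commuting endomorphisms of flag representations over a field -/

section FieldDimension

variable {k : Type u} [Field k] {g : Type v} [LieRing g] [LieAlgebra k g]
variable {K : Type u} [Field K] [Algebra k K]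
variable {V : Type u} [AddCommGroup V] [Module K V]
variable {r : K ⊗[k] g →ₗ⁅K⁆ Module.End K V} {n : ℕ}

theorem IsFieldFlag.exists_normalized_frame (hr : IsFieldFlag r n) :
    ∃ (x : ℕ → V) (ξ : ℕ → V →ₗ[K] K),
      IsFrame r n K x ξ ∧ ∀ i < n, ξ i (x i) = 1 := by
  obtain ⟨x, ξ, h⟩ := hr.isFlag.exists_frame K
  have h1 : ∀ i < n, (ξ i (x i))⁻¹ • ξ i (x i) = 1 := fun i hi => inv_mul_cancel₀ (h.ne_zero i hi)
  refine ⟨x, fun i => (ξ i (x i))⁻¹ • ξ i, ⟨h.mem, fun i hi e he => ?_, fun i hi => ?_⟩, h1⟩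
  · simp [h.eq_zero i hi e he]
  · rw [LinearMap.smul_apply, h1 i hi]
    simp

theorem sub_smul_mem_fil (hr : IsFieldFlag r n) {x : ℕ → V} {ξ : ℕ → V →ₗ[K] K}
    (hx : IsFrame r n K x ξ) (h1 : ∀ i < n, ξ i (x i) = 1) {i : ℕ} (hi : i < n) {e : V}
    (he : e ∈ fil r (i + 1)) : e - ξ i e • x i ∈ fil r i := by
  have h := hr.isFlag.proportional hi (hx.eq_zero i hi) (hx.mem i hi) he
  rwa [h1 i hi, one_smul] at h

theorem mem_ker_grMapLin_iff (hr : IsFieldFlag r n) {x : ℕ → V} {ξ : ℕ → V →ₗ[K] K}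
    (hx : IsFrame r n K x ξ) (h1 : ∀ i < n, ξ i (x i) = 1) {i : ℕ} (hi : i + 1 < n)
    (v : K ⊗[k] g) : v ∈ LinearMap.ker (grMapLin r i) ↔ ξ i (r v (x (i + 1))) = 0 := by
  rw [mem_ker_grMapLin]
  constructor
  · exact fun h => hx.eq_zero i (by omega) _ (h _ (hx.mem _ hi))
  · intro h e he
    have h2 := sub_smul_mem_fil hr hx h1 (i := i) (by omega)
      ((mem_fil_succ _ _ _).1 (hx.mem _ hi) v)
    rw [h, zero_smul, sub_zero] at h2
    have h3 := (mem_fil_succ _ _ _).1 (sub_smul_mem_fil hr hx h1 hi he) v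
    rw [map_sub, map_smul] at h3
    exact (Submodule.sub_mem_iff_left _ (Submodule.smul_mem _ _ h2)).1 h3

theorem exists_smul_of_ker_le {W : Type*} [AddCommGroup W] [Module K W] (φ ψ : W →ₗ[K] K)
    (h : LinearMap.ker ψ ≤ LinearMap.ker φ) : ∃ s : K, ∀ w, φ w = s * ψ w := by
  by_cases hψ : ∀ w, ψ w = 0
  · refine ⟨0, fun w => ?_⟩
    rw [zero_mul]
    exact h (hψ w)
  · push Not at hψ
    obtain ⟨w₀, hw⟩ := hψ
    refine ⟨φ w₀ / ψ w₀, fun w => ?_⟩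
    have h1 : φ (w - (ψ w / ψ w₀) • w₀) = 0 := h (by simp [hw])
    rw [map_sub, map_smul, sub_eq_zero, smul_eq_mul] at h1
    rw [h1]
    ring

/-- A map from the last line to the first commutes with `r` and lowers the filtration, adding one
dimension to the scalars. -/
theorem IsFieldFlag.two_le_autDim (hr : IsFieldFlag r (n + 2)) : 2 ≤ autDim r := by
  obtain ⟨x, ξ, hx, h1⟩ := hr.exists_normalized_frame
  have htop : fil r (n + 2) = ⊤ := hr.isFlag.fil_eq_top le_rfl
  refine le_sInf ?_
  rintro _ ⟨R, _, _, _, _, hR, rfl⟩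
  have := le_ringKrullDim_of_isAutRing hR htop (m := 1)
    (fun _ => (ξ (n + 1)).smulRight (x 0)) (fun _ v e => ?_) (fun _ j e he => ?_)
    (hx.mem 0 (by omega)) (h1 0 (by omega)) (fun _ => x (n + 1)) (fun _ => ξ 0) (fun i j => ?_)
  · refine le_trans ?_ this
    norm_num
  · have h2 : r v e ∈ fil r (n + 1) := (mem_fil_succ _ _ _).1 (htop ▸ Submodule.mem_top) v
    rw [LinearMap.smulRight_apply, hx.eq_zero _ (by omega) _ h2, LinearMap.smulRight_apply,
      map_smul, (mem_fil_one _ _).1 (hx.mem 0 (by omega))]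
    simp
  · rw [LinearMap.smulRight_apply]
    rcases le_or_gt (n + 1) j with h | h
    · exact Submodule.smul_mem _ _ (fil_mono r (by omega : 1 ≤ j) (hx.mem 0 (by omega)))
    · rw [hx.eq_zero _ (by omega) _ (fil_mono r (by omega) he), zero_smul]
      exact zero_mem _
  · simp [Subsingleton.elim i j, h1]

/-- If the first and the last point of the constellation coincide, there is an additional
one-parameter family of automorphisms. -/
theorem IsFieldFlag.three_le_autDim (hr : IsFieldFlag r (n + 3))
    (hk : LinearMap.ker (grMapLin r 0) = LinearMap.ker (grMapLin r (n + 1))) : 3 ≤ autDim r := by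
  obtain ⟨x, ξ, hx, h1⟩ := hr.exists_normalized_frame
  have htop : fil r (n + 3) = ⊤ := hr.isFlag.fil_eq_top le_rfl
  -- Equal kernels make the first entry a multiple `s` of the last.
  obtain ⟨s, hs⟩ : ∃ s : K, ∀ v, ξ 0 (r v (x 1)) = s * ξ (n + 1) (r v (x (n + 2))) := by
    have := exists_smul_of_ker_le
      (ξ 0 ∘ₗ LinearMap.applyₗ (x 1) ∘ₗ (r : K ⊗[k] g →ₗ[K] Module.End K V))
      (ξ (n + 1) ∘ₗ LinearMap.applyₗ (x (n + 2)) ∘ₗ (r : K ⊗[k] g →ₗ[K] Module.End K V))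
      fun v hv => by
        have h2 := (mem_ker_grMapLin_iff hr hx h1 (i := n + 1) (by omega) v).2 hv
        rw [← hk] at h2
        exact (mem_ker_grMapLin_iff hr hx h1 (i := 0) (by omega) v).1 h2
    exact this
  have hx0 : ∀ v, r v (x 0) = 0 := (mem_fil_one _ _).1 (hx.mem 0 (by omega))
  have hdown : ∀ v e, r v e ∈ fil r (n + 2) :=
    fun v e => (mem_fil_succ _ _ _).1 (htop ▸ Submodule.mem_top) v
  have hx1 : ∀ v, r v (x 1) = ξ 0 (r v (x 1)) • x 0 := fun v => by
    have := sub_smul_mem_fil hr hx h1 (i := 0) (by omega)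
      ((mem_fil_succ _ _ _).1 (hx.mem 1 (by omega)) v)
    rwa [fil_zero, Submodule.mem_bot, sub_eq_zero] at this
  have hentry : ∀ v e, ξ (n + 1) (r v e) = ξ (n + 2) e * ξ (n + 1) (r v (x (n + 2))) := by
    intro v e
    have h2 := (mem_fil_succ _ _ _).1
      (sub_smul_mem_fil hr hx h1 (i := n + 2) (by omega) (htop ▸ Submodule.mem_top : e ∈ _)) v
    have h3 := hx.eq_zero _ (by omega) _ h2
    rwa [map_sub, map_smul, map_sub, map_smul, sub_eq_zero, smul_eq_mul] at h3
  have h01 : ξ 1 (x 0) = 0 := hx.eq_zero 1 (by omega) _ (hx.mem 0 (by omega))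
  -- The second map sends the last line to the second and compensates with `s` times a map from the
  -- next-to-last line to the first; commuting with `r` is then exactly `hs`.
  let h' : Fin 2 → V →ₗ[K] V := ![(ξ (n + 2)).smulRight (x 0),
    s • (ξ (n + 1)).smulRight (x 0) + (ξ (n + 2)).smulRight (x 1)]
  have hh : ∀ e, h' 1 e = s • ξ (n + 1) e • x 0 + ξ (n + 2) e • x 1 := fun e => rfl
  refine le_sInf ?_
  rintro _ ⟨R, _, _, _, _, hR, rfl⟩
  have := le_ringKrullDim_of_isAutRing hR htop h' (Fin.forall_fin_two.2 ⟨fun v e => ?_, fun v e => ?_⟩)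
    (Fin.forall_fin_two.2 ⟨fun j e he => ?_, fun j e he => ?_⟩)
    (hx.mem 0 (by omega)) (h1 0 (by omega)) (fun _ => x (n + 2))
    -- The multiple of `ξ 1` makes the first form vanish on `h' 1 (x (n + 2))`; it does not affect
    -- the value on `x 0`, where `ξ 1` is zero.
    ![ξ 0 - (s * ξ (n + 1) (x (n + 2)) + ξ 0 (x 1)) • ξ 1, ξ 1] (fun i j => ?_)
  · refine le_trans ?_ this
    norm_num
  · simp [h', hx0, hx.eq_zero (n + 2) (by omega) _ (hdown v e)]
  · simp only [hh, map_add, map_smul, hx0, smul_zero, zero_add,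
      hx.eq_zero (n + 2) (by omega) _ (hdown v e), zero_smul, add_zero]
    rw [hx1 v, hentry, hs, smul_smul, smul_smul]
    congr 1
    ring
  · simp only [h', Matrix.cons_val_zero, LinearMap.smulRight_apply]
    rcases le_or_gt (n + 2) j with h | h
    · exact Submodule.smul_mem _ _ (fil_mono r (by omega : 1 ≤ j) (hx.mem 0 (by omega)))
    · rw [hx.eq_zero _ (by omega) _ (fil_mono r (by omega) he), zero_smul]
      exact zero_mem _
  · rw [hh]
    refine add_mem (Submodule.smul_mem _ _ ?_) ?_
    · rcases le_or_gt (n + 1) j with h | h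
      · exact Submodule.smul_mem _ _ (fil_mono r (by omega : 1 ≤ j) (hx.mem 0 (by omega)))
      · rw [hx.eq_zero _ (by omega) _ (fil_mono r (by omega) he), zero_smul]
        exact zero_mem _
    · rcases le_or_gt (n + 2) j with h | h
      · exact Submodule.smul_mem _ _ (fil_mono r (by omega : 2 ≤ j) (hx.mem 1 (by omega)))
      · rw [hx.eq_zero _ (by omega) _ (fil_mono r (by omega) he), zero_smul]
        exact zero_mem _
  · fin_cases i <;> fin_cases j <;>
      simp [h', h1 0, h1 1, h1 (n + 2), h01]

end FieldDimension

/-! ### Nondegenerate means wide -/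

section Nondegenerate

variable {k : Type u} [Field k] {g : Type v} [LieRing g] [LieAlgebra k g]

/-- Some wide representation has dimension m + 1 with m > n, even when the width is infinite, and
the steps of its filtration are wide. -/
theorem exists_isWide {n : ℕ} (hn : ((n + 2 : ℕ) : ℕ∞) ≤ width k g + 1) :
    ∃ (K : Type u) (_ : Field K) (_ : Algebra k K) (V : Type u) (_ : AddCommGroup V)
      (_ : Module K V) (r : K ⊗[k] g →ₗ⁅K⁆ Module.End K V), IsWide r (n + 2) := by
  have h1 : ((n : ℕ) : ℕ∞) < width k g := by
    have h2 : ((n + 1 : ℕ) : ℕ∞) + 1 ≤ width k g + 1 := by exact_mod_cast hn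
    have h3 : ((n + 1 : ℕ) : ℕ∞) ≤ width k g := (ENat.add_le_add_iff_right ENat.one_ne_top).1 h2
    exact lt_of_lt_of_le (by exact_mod_cast Nat.lt_succ_self n) h3
  obtain ⟨_, ⟨m, rfl, K, _, _, V, _, _, r, hr⟩, hm⟩ := lt_sSup_iff.1 h1
  have hm' : n < m := by exact_mod_cast hm
  exact ⟨K, _, _, fil r (n + 2), _, _, subFil r (n + 2), hr.subFil (by omega)⟩

/-- Over a field, nondegenerate representations of dimension at most one more than the width are
the wide ones. -/
theorem isFieldNondeg_iff_isWide {n : ℕ} (hn : (n : ℕ∞) ≤ width k g + 1)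
    {K : Type u} [Field K] [Algebra k K] {V : Type u} [AddCommGroup V] [Module K V]
    (r : K ⊗[k] g →ₗ⁅K⁆ Module.End K V) : IsFieldNondeg k g n K V r ↔ IsWide r n := by
  induction n using Nat.strong_induction_on generalizing K V with
  | _ n ih =>
  match n with
  | 0 => exact ⟨fun h => ⟨h, fun i => i.elim0⟩, fun h => h.1⟩
  | 1 => exact ⟨fun h => ⟨h, fun i => i.elim0⟩, fun h => h.1⟩
  | n + 2 =>
    have hn' : ((n + 1 : ℕ) : ℕ∞) ≤ width k g + 1 :=
      le_trans (by exact_mod_cast Nat.le_succ _) hn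
    have ih' := fun {K : Type u} [Field K] [Algebra k K] {V : Type u} [AddCommGroup V]
      [Module K V] (r : K ⊗[k] g →ₗ⁅K⁆ Module.End K V) => ih (n + 1) (by omega) hn' r
    constructor
    · rintro ⟨hf, hsub, hquot, hmin⟩
      rw [ih', isWide_iff] at hsub hquot
      have hr := hf.isFlag
      obtain ⟨K', _, _, V', _, _, r', hr'⟩ := exists_isWide hn
      -- By induction the wide representation competes in the minimality condition.
      have hdim : autDim r ≤ 2 := (hmin K' V' r' hr'.1 ((ih' _).2 (hr'.subFil (by omega)))
        ((ih' _).2 hr'.quotFil)).trans hr'.autDim_le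
      refine isWide_iff.2 ⟨hf, ?_⟩
      -- A pair avoiding the last point is separated in the subrepresentation, one avoiding the
      -- first point in the quotient. For the pair (0, n), coincidence would give dim Aut ≥ 3.
      have hlt : ∀ i j, i < j → j + 1 < n + 2 →
          LinearMap.ker (grMapLin r i) ≠ LinearMap.ker (grMapLin r j) := by
        intro i j hij hj heq
        rcases Nat.lt_or_ge (j + 1) (n + 1) with h | h
        · have hk : ∀ i, i + 1 < n + 1 → LinearMap.ker (grMapLin (subFil r (n + 1)) i) =
              LinearMap.ker (grMapLin r i) := fun i hi =>
            ker_grMapLin_of_injective (fil r (n + 1)).subtype_injective (subtype_subFil r (n + 1))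
              (by simpa using fil_mono r (by omega))
          have := hsub.2 i j (by omega) h (by rw [hk i (by omega), hk j h, heq])
          omega
        · rcases Nat.eq_zero_or_pos i with rfl | hi
          · obtain rfl : j = n := by omega
            obtain ⟨m, rfl⟩ : ∃ m, j = m + 1 := ⟨j - 1, by omega⟩
            have h3 := (hf.three_le_autDim heq).trans hdim
            exact absurd h3 (by norm_num)
          · obtain ⟨i, rfl⟩ : ∃ m, i = m + 1 := ⟨i - 1, by omega⟩
            obtain ⟨j, rfl⟩ : ∃ m, j = m + 1 := ⟨j - 1, by omega⟩
            have hk := ker_grMapLin_of_surjective (s := quotFil r 1) (fil r 1).mkQ_surjective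
              (by simp) (mkQ_quotFil r 1)
            have := hquot.2 i j (by omega) (by omega) (by rw [hk, hk, heq])
            omega
      intro i j hi hj heq
      rcases lt_trichotomy i j with h | h | h
      · exact absurd heq (hlt i j h hj)
      · exact h
      · exact absurd heq.symm (hlt j i h hi)
    · intro hr
      exact ⟨hr.1, (ih' _).2 (hr.subFil (by omega)), (ih' _).2 hr.quotFil,
        fun K' _ _ V' _ _ r' hf' _ _ => hr.autDim_le.trans hf'.two_le_autDim⟩

theorem IsNondeg.isFieldNondeg {A : Type u} [CommRing A] [Algebra k A] {E : Type u}
    [AddCommGroup E] [Module A E] {n : ℕ} {r : A ⊗[k] g →ₗ⁅A⁆ Module.End A E}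
    (h : IsNondeg k g A n E r) (t : PrimeSpectrum A) :
    IsFieldNondeg k g n t.asIdeal.ResidueField _ (fiber r t) := by
  cases n with
  | zero => exact h.2.1 t
  | succ n => exact h.2.2.2.1 t

/-- Flagness and wideness of the fibres both pass to r_{n-1} and r^1, so the recursion closes, with
`IsFlag.autFlat` supplying flatness at every level. -/
theorem isNondeg_of_stepInjective {A : Type u} [CommRing A] [Algebra k A] {E : Type u}
    [AddCommGroup E] [Module A E] {n : ℕ} (hn : (n : ℕ∞) ≤ width k g + 1)
    {r : A ⊗[k] g →ₗ⁅A⁆ Module.End A E} (hr : IsFlag r n)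
    (hw : ∀ t : PrimeSpectrum A, StepInjective (fiber r t) n) : IsNondeg k g A n E r := by
  have hfib : ∀ t : PrimeSpectrum A, IsFieldNondeg k g n t.asIdeal.ResidueField _ (fiber r t) :=
    fun t => (isFieldNondeg_iff_isWide hn _).2 (isWide_iff.2 ⟨hr.baseChange_field _, hw t⟩)
  induction n generalizing E with
  | zero => exact ⟨hr, hfib, hr.autFlat hw⟩
  | succ n ih =>
    have hn' : (n : ℕ∞) ≤ width k g + 1 := le_trans (by exact_mod_cast Nat.le_succ _) hn
    have hfib' : ∀ {E' : Type u} [AddCommGroup E'] [Module A E']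
        {r' : A ⊗[k] g →ₗ⁅A⁆ Module.End A E'}, IsFlag r' n →
        (∀ t : PrimeSpectrum A, StepInjective (fiber r' t) n) → IsNondeg k g A n E' r' :=
      fun hr' hw' => ih hn' hr' hw' fun t =>
        (isFieldNondeg_iff_isWide hn' _).2 (isWide_iff.2 ⟨hr'.baseChange_field _, hw' t⟩)
    exact ⟨hr, hfib' (hr.subFil (by omega)) fun t => (hw t).baseChange_subFil hr _ (by omega),
      hfib' hr.quotFil fun t => (hw t).baseChange_quotFil hr _, hfib, hr.autFlat hw⟩

end Nondegenerate

end FlagRep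

theorem proposition9p1 (k : Type u) [Field k] (g : Type v) [LieRing g] [LieAlgebra k g]
    (hg : ∃ s : Set g, s.Finite ∧ LieSubalgebra.lieSpan k g s = ⊤)
    (A : Type u) [CommRing A] [Algebra k A] (E : Type u) [AddCommGroup E] [Module A E]
    (n : ℕ) (hn : (n : ℕ∞) ≤ FlagRep.width k g + 1)
    (r : A ⊗[k] g →ₗ⁅A⁆ Module.End A E) (hr : FlagRep.IsFlag r n) :
    FlagRep.IsNondeg k g A n E r ↔
      ∀ t : PrimeSpectrum A, Function.Injective (FlagRep.constellation (FlagRep.fiber r t) n) :=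
  ⟨fun h t => ((FlagRep.isFieldNondeg_iff_isWide hn _).1 (h.isFieldNondeg t)).2,
    fun h => FlagRep.isNondeg_of_stepInjective hn hr
      fun t => FlagRep.constellation_injective_iff.1 (h t)⟩
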